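/- Let $d\ge 0$ and let $W\subseteq\mathbb R\times\mathbb R^d$ be open, with coordinates $(t,x)$. Let $\Omega>0$, $\bar U$, $\bar A_i$ and a symmetric positive definite matrix $\bar g_{ij}$ ($1\le i,j\le d$) be smooth functions of $(t,x)\in W$. On $\mathbb R\times W$, with coordinates $(u,t,x)$ and dimension $D=d+2$, consider the metric of a Platonic wave $$g=\Omega\,\bar g,\qquad \bar g=2\,dt\,\bigl(du+\bar A_i\,dx^i-\bar U\,dt\bigr)+\bar g_{ij}\,dx^i\,dx^j .$$ Let $\Box_Y=\Box-\frac{D-2}{4(D-1)}R$ be the Yamabe operator of $g$, where $\Box=\nabla^\mu\nabla_\mu$ and $R$ is the scalar curvature of $g$ (with the sign convention in which round spheres have positive scalar curvature). For fixed $t$ let $\bar\nabla$ and $\bar R^{(d)}$ be the Levi-Civita connection and the scalar curvature of the Riemannian metric $\bar g_{ij}(t,\cdot)$, put $D_i=\bar\nabla_i-im\bar A_i$, $D^2=\bar g^{ij}D_iD_j$, and $\bar g^{(d)}=\det(\bar g_{ij})$. Let $m,M\in\mathbb R$, let $\phi:W\to\mathbb C$ be twice continuously differentiable, and put $\Phi(u,t,x)=\Omega^{-d/4}\,\phi(t,x)\,e^{imu}$.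 Then at every point of $\mathbb R\times W$ $$(\Box_Y-M^2)\Phi=\Omega^{-1-\frac d4}\,e^{imu}\Bigl[D^2\phi+2im\,\partial_t\phi+\tfrac12\,im\,\partial_t(\ln\bar g^{(d)})\,\phi-\Bigl(M^2\Omega+2m^2\bar U+\tfrac{d}{4(d+1)}\bar R^{(d)}\Bigr)\phi\Bigr].$$ Consequently, if $m\neq0$, the Klein–Gordon equation $(\Box_Y-M^2)\Phi=0$ holds at a point $(u,t,x)$ if and only if the Schrödinger equation $$i\,\partial_t\phi=\Bigl[-\frac1{2m}\Bigl(D^2-\frac{d}{4(d+1)}\bar R^{(d)}\Bigr)+m\,\bar V-\frac i4\,\partial_t\bigl(\ln\bar g^{(d)}\bigr)\Bigr]\phi,\qquad \bar V=\bar U+\frac{M^2\Omega}{2m^2},$$ holds at $(t,x)$. -/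

import Mathlib

open scoped ContDiff

noncomputable section

/-! Pseudo-Riemannian geometry in a coordinate chart with finite index type `ι`. -/

section Chart

variable {ι : Type} [Fintype ι] [DecidableEq ι]

/-- The partial derivative `∂_i f` at the point `x`. -/
def pd {E : Type} [NormedAddCommGroup E] [NormedSpace ℝ E]
    (i : ι) (f : (ι → ℝ) → E) (x : ι → ℝ) : E :=
  fderiv ℝ f x (Pi.single i 1)

/-- The Christoffel symbol
`Γ^k_{ij} = (1/2) g^{kl} (∂_i g_{jl} + ∂_j g_{il} - ∂_l g_{ij})` of the metric `g`. -/
def christoffel (g : (ι → ℝ) → Matrix ι ι ℝ) (k i j : ι) (x : ι → ℝ) : ℝ :=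
  (1 / 2) * ∑ l, (g x)⁻¹ k l *
    (pd i (fun y => g y j l) x + pd j (fun y => g y i l) x - pd l (fun y => g y i j) x)

/-- The Ricci tensor
`R_{ij} = ∂_k Γ^k_{ij} - ∂_j Γ^k_{ik} + Γ^k_{kl} Γ^l_{ij} - Γ^k_{jl} Γ^l_{ik}`
(positive on round spheres). -/
def ricci (g : (ι → ℝ) → Matrix ι ι ℝ) (i j : ι) (x : ι → ℝ) : ℝ :=
  ∑ k, (pd k (christoffel g k i j) x - pd j (christoffel g k i k) x) +
    ∑ k, ∑ l, (christoffel g k k l x * christoffel g l i j x -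
      christoffel g k j l x * christoffel g l i k x)

/-- The scalar curvature `R = g^{ij} R_{ij}`. -/
def scalarCurvature (g : (ι → ℝ) → Matrix ι ι ℝ) (x : ι → ℝ) : ℝ :=
  ∑ i, ∑ j, (g x)⁻¹ i j * ricci g i j x

/-- The Laplace-Beltrami operator
`□Φ = ∇^μ ∇_μ Φ = g^{μν} (∂_μ ∂_ν Φ - Γ^λ_{μν} ∂_λ Φ)` on complex scalar fields. -/
def laplaceBeltrami (g : (ι → ℝ) → Matrix ι ι ℝ) (Φ : (ι → ℝ) → ℂ) (x : ι → ℝ) : ℂ :=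
  ∑ i, ∑ j, (((g x)⁻¹ i j : ℝ) : ℂ) *
    (pd i (pd j Φ) x - ∑ k, (christoffel g k i j x : ℂ) * pd k Φ x)

/-- The Yamabe operator `□_Y = □ - (D - 2) / (4 (D - 1)) R` in dimension `D`. -/
def yamabe (g : (ι → ℝ) → Matrix ι ι ℝ) (Φ : (ι → ℝ) → ℂ) (x : ι → ℝ) : ℂ :=
  laplaceBeltrami g Φ x -
    ((((Fintype.card ι : ℝ) - 2) / (4 * ((Fintype.card ι : ℝ) - 1)) * scalarCurvature g x : ℝ) : ℂ)
      * Φ x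

/-- The gauge covariant derivative `D_i φ = ∂_i φ - i m a_i φ` of a scalar `φ`. -/
def gaugeDeriv (m : ℝ) (a : (ι → ℝ) → ι → ℝ) (i : ι) (φ : (ι → ℝ) → ℂ) (x : ι → ℝ) : ℂ :=
  pd i φ x - Complex.I * (m : ℂ) * (a x i : ℂ) * φ x

/-- The gauge covariant Laplacian `D² φ = g^{ij} D_i D_j φ`, where `D = ∇ - i m a` acts on the
1-form `D φ` through the Levi-Civita connection of `g`. -/
def gaugeLaplacian (g : (ι → ℝ) → Matrix ι ι ℝ) (m : ℝ) (a : (ι → ℝ) → ι → ℝ)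
    (φ : (ι → ℝ) → ℂ) (x : ι → ℝ) : ℂ :=
  ∑ i, ∑ j, (((g x)⁻¹ i j : ℝ) : ℂ) *
    (gaugeDeriv m a i (gaugeDeriv m a j φ) x -
      ∑ k, (christoffel g k i j x : ℂ) * gaugeDeriv m a k φ x)

end Chart

/-- Labels of the ambient coordinates `(u, t, x^1, …, x^d)`. -/
inductive WaveIndex (d : ℕ) : Type where
  | u : WaveIndex d
  | t : WaveIndex d
  | x (i : Fin d) : WaveIndex d

/-- The coordinate labels as an iterated option type. -/
def waveIndexEquiv (d : ℕ) : WaveIndex d ≃ Option (Option (Fin d)) where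
  toFun
    | .u => none
    | .t => some none
    | .x i => some (some i)
  invFun
    | none => .u
    | some none => .t
    | some (some i) => .x i
  left_inv p := by cases p <;> rfl
  right_inv p := by rcases p with _ | _ | _ <;> rfl

instance (d : ℕ) : DecidableEq (WaveIndex d) := (waveIndexEquiv d).decidableEq

instance (d : ℕ) : Fintype (WaveIndex d) := Fintype.ofEquiv _ (waveIndexEquiv d).symm

/-- The data of a Platonic wave with `d` transverse dimensions, in coordinates `(u, t, x)` with
`(t, x)` in an open set: the line element
`Ω [2 dt (du + A_i dx^i - U dt) + h_ij dx^i dx^j]` whose coefficients are smooth functions of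
`(t, x)`, with `Ω > 0` and `h` symmetric and positive definite. -/
structure PlatonicWave (d : ℕ) where
  /-- The range of the coordinates `(t, x)`. -/
  domain : Set (ℝ × (Fin d → ℝ))
  isOpen_domain : IsOpen domain
  /-- The time unit (conformal factor). -/
  Ω : ℝ × (Fin d → ℝ) → ℝ
  /-- The scalar potential. -/
  U : ℝ × (Fin d → ℝ) → ℝ
  /-- The Coriolis 1-form (vector potential). -/
  A : ℝ × (Fin d → ℝ) → Fin d → ℝ
  /-- The spatial metric. -/
  h : ℝ × (Fin d → ℝ) → Matrix (Fin d) (Fin d) ℝ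
  smooth_Ω : ContDiffOn ℝ ∞ Ω domain
  smooth_U : ContDiffOn ℝ ∞ U domain
  smooth_A : ∀ i, ContDiffOn ℝ ∞ (fun q => A q i) domain
  smooth_h : ∀ i j, ContDiffOn ℝ ∞ (fun q => h q i j) domain
  Ω_pos : ∀ q ∈ domain, 0 < Ω q
  h_posDef : ∀ q ∈ domain, (h q).PosDef

namespace PlatonicWave

variable {d : ℕ} (P : PlatonicWave d)

/-- The projection `(u, t, x) ↦ (t, x)`. -/
def base (p : WaveIndex d → ℝ) : ℝ × (Fin d → ℝ) := (p .t, fun i => p (.x i))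

/-- The metric `2 dt (du + A_i dx^i - U dt) + h_ij dx^i dx^j`. -/
def bargmannMetric (p : WaveIndex d → ℝ) : Matrix (WaveIndex d) (WaveIndex d) ℝ :=
  Matrix.of fun
    | .u, .u => 0
    | .u, .t => 1
    | .t, .u => 1
    | .u, .x _ => 0
    | .x _, .u => 0
    | .t, .t => -2 * P.U (base p)
    | .t, .x i => P.A (base p) i
    | .x i, .t => P.A (base p) i
    | .x i, .x j => P.h (base p) i j

/-- The metric of the Platonic wave, conformal to the previous one with factor `Ω(t, x)`. -/
def metric (p : WaveIndex d → ℝ) : Matrix (WaveIndex d) (WaveIndex d) ℝ :=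
  P.Ω (base p) • P.bargmannMetric p

/-- The ansatz `Φ(u, t, x) = Ω^{-d/4} φ(t, x) e^{i m u}`. -/
def ansatz (m : ℝ) (φ : ℝ × (Fin d → ℝ) → ℂ) (p : WaveIndex d → ℝ) : ℂ :=
  ((P.Ω (base p) ^ (-(d : ℝ) / 4) : ℝ) : ℂ) * φ (base p) * Complex.exp (Complex.I * m * p .u)

/-- `(□_Y - M²) Φ` for the metric of the Platonic wave. -/
def kleinGordon (M : ℝ) (Φ : (WaveIndex d → ℝ) → ℂ) (p : WaveIndex d → ℝ) : ℂ :=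
  yamabe P.metric Φ p - (M : ℂ) ^ 2 * Φ p

/-- `D² φ` at `(t, x)`: the gauge covariant Laplacian of the spatial metric `h(t, ·)` at fixed
time `t`, with `D = ∇ - i m A`. -/
def gaugeLap (m : ℝ) (φ : ℝ × (Fin d → ℝ) → ℂ) (q : ℝ × (Fin d → ℝ)) : ℂ :=
  gaugeLaplacian (fun y => P.h (q.1, y)) m (fun y => P.A (q.1, y)) (fun y => φ (q.1, y)) q.2

/-- The scalar curvature at `(t, x)` of the spatial metric `h(t, ·)` at fixed time `t`. -/
def spatialCurvature (q : ℝ × (Fin d → ℝ)) : ℝ :=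
  scalarCurvature (fun y => P.h (q.1, y)) q.2

/-- `∂_t (ln det h)`. -/
def dtLogDet (q : ℝ × (Fin d → ℝ)) : ℝ :=
  deriv (fun s => Real.log (P.h (s, q.2)).det) q.1

/-- The effective potential `V = U + M² Ω / (2 m²)`. -/
def effectivePotential (m M : ℝ) (q : ℝ × (Fin d → ℝ)) : ℝ :=
  P.U q + M ^ 2 * P.Ω q / (2 * m ^ 2)

/-- The equation
`i ∂_t φ = [-(1/2m) (D² - d/(4(d+1)) R) + m V - (i/4) ∂_t (ln det h)] φ` at the point `(t, x)`. -/
def SchrodingerAt (m M : ℝ) (φ : ℝ × (Fin d → ℝ) → ℂ) (q : ℝ × (Fin d → ℝ)) : Prop :=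
  Complex.I * deriv (fun s => φ (s, q.2)) q.1 =
    -(1 / (2 * (m : ℂ))) *
        (P.gaugeLap m φ q - ((d : ℂ) / (4 * ((d : ℂ) + 1))) * (P.spatialCurvature q : ℂ) * φ q) +
      (m : ℂ) * (P.effectivePotential m M q : ℂ) * φ q -
      (Complex.I / 4) * (P.dtLogDet q : ℂ) * φ q

end PlatonicWave

end

set_option linter.unusedSectionVars false

/-! ### Partial derivatives -/

section PartialDerivative

variable {ι : Type} [Fintype ι] [DecidableEq ι]
  {E : Type} [NormedAddCommGroup E] [NormedSpace ℝ E]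

/-! The conformal factor is removed first, and then a wave equation on a metric with a parallel null
vector is reduced by a Fourier mode along that vector.

Conformal covariance (`yamabe_smul`): in dimension `n`, with `s = -(n-2)/4`, the Yamabe operator of
`Ω g` applied to `Ω^s f` is `Ω^(s-1)` times that of `g` applied to `f`. Put `ω = d ln Ω`. The
Christoffel symbols change by a tensor linear in `ω`. For this `s` the first-order terms in the
Laplacian cancel, leaving the extra potential `s Δ ln Ω - s² |ω|²`, which the change of scalar
curvature removes. Here `n = d + 2`, so `s = -d/4`, and the mass term `M² Ω^s = Ω^(s-1) (M² Ω)`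
supplies the `M² Ω` in the bracket.

Bargmann metric: `∂_u` is null and covariantly constant, so every Christoffel symbol with upper
index `t` or lower index `u` vanishes. The inverse metric has no `tt` or `tx` entries and Ricci
vanishes along `u`, so the scalar curvature is that of `h(t, ·)` (`scalarCurvature_bargmann`).

On `φ e^{imu}` the derivative `∂_u` is multiplication by `im`. The inverse entries `g^{uu} = 2U +
|A|²`, `g^{ut} = 1`, `g^{ui} = -A^i`, together with `h^{ij} Γ^u_{ij} = div A - (1/2) ∂_t ln det h`,
supply `2im ∂_t`, the determinant term, `-2m² U` and exactly the terms that complete `Δ` to the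
gauge Laplacian (`gaugeLaplacian_eq`, `laplaceBeltrami_bargmann`). The Schrödinger equation is the
vanishing of the bracket divided by `2m`. -/

theorem pd_congr {f g : (ι → ℝ) → E} {x : ι → ℝ} (i : ι) (h : f =ᶠ[nhds x] g) :
    pd i f x = pd i g x := by
  simp only [pd, h.fderiv_eq]

theorem pd_congr_of_isOpen {f g : (ι → ℝ) → E} {S : Set (ι → ℝ)} {x : ι → ℝ} (hS : IsOpen S)
    (hx : x ∈ S) (i : ι) (h : ∀ y ∈ S, f y = g y) : pd i f x = pd i g x :=
  pd_congr i (Filter.eventually_of_mem (hS.mem_nhds hx) h)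

@[simp] theorem pd_const (i : ι) (c : E) (x : ι → ℝ) : pd i (fun _ => c) x = 0 := by
  simp [pd]

theorem pd_add (i : ι) {f g : (ι → ℝ) → E} {x : ι → ℝ} (hf : DifferentiableAt ℝ f x)
    (hg : DifferentiableAt ℝ g x) :
    pd i (fun y => f y + g y) x = pd i f x + pd i g x := by
  simp [pd, fderiv_fun_add hf hg]

theorem pd_sub (i : ι) {f g : (ι → ℝ) → E} {x : ι → ℝ} (hf : DifferentiableAt ℝ f x)
    (hg : DifferentiableAt ℝ g x) :
    pd i (fun y => f y - g y) x = pd i f x - pd i g x := by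
  simp [pd, fderiv_fun_sub hf hg]

theorem pd_sum {κ : Type*} (s : Finset κ) (i : ι) {f : κ → (ι → ℝ) → E} {x : ι → ℝ}
    (hf : ∀ k ∈ s, DifferentiableAt ℝ (f k) x) :
    pd i (fun y => ∑ k ∈ s, f k y) x = ∑ k ∈ s, pd i (f k) x := by
  simp [pd, fderiv_fun_sum hf]

theorem pd_mul {𝔸 : Type} [NormedCommRing 𝔸] [NormedAlgebra ℝ 𝔸] (i : ι) {f g : (ι → ℝ) → 𝔸}
    {x : ι → ℝ} (hf : DifferentiableAt ℝ f x) (hg : DifferentiableAt ℝ g x) :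
    pd i (fun y => f y * g y) x = pd i f x * g x + f x * pd i g x := by
  simp [pd, fderiv_fun_mul hf hg, mul_comm, add_comm]

theorem pd_const_mul {𝔸 : Type} [NormedCommRing 𝔸] [NormedAlgebra ℝ 𝔸] (i : ι) (c : 𝔸)
    {f : (ι → ℝ) → 𝔸} {x : ι → ℝ} (hf : DifferentiableAt ℝ f x) :
    pd i (fun y => c * f y) x = c * pd i f x := by
  rw [pd_mul i (differentiableAt_const c) hf]; simp

theorem pd_comp_hasDerivAt (i : ι) {f : (ι → ℝ) → ℝ} {F : ℝ → ℝ} {F' : ℝ} {x : ι → ℝ}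
    (hf : DifferentiableAt ℝ f x) (hF : HasDerivAt F F' (f x)) :
    pd i (fun y => F (f y)) x = F' * pd i f x := by
  have := (hF.comp_hasFDerivAt x hf.hasFDerivAt).fderiv
  simp only [pd]
  change fderiv ℝ (F ∘ f) x _ = _
  rw [this]; simp

theorem pd_ofReal (i : ι) {f : (ι → ℝ) → ℝ} {x : ι → ℝ} (hf : DifferentiableAt ℝ f x) :
    pd i (fun y => (f y : ℂ)) x = ((pd i f x : ℝ) : ℂ) := by
  have := (Complex.ofRealCLM.hasFDerivAt.comp x hf.hasFDerivAt).fderiv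
  simp only [pd]
  change fderiv ℝ (Complex.ofRealCLM ∘ f) x _ = _
  rw [this]; simp

theorem contDiffAt_pd {m n : WithTop ℕ∞} (i : ι) {f : (ι → ℝ) → E} {x : ι → ℝ}
    (hf : ContDiffAt ℝ n f x) (hmn : m + 1 ≤ n) : ContDiffAt ℝ m (pd i f) x :=
  (hf.fderiv_right hmn).clm_apply contDiffAt_const

theorem contDiffOn_pd {m n : WithTop ℕ∞} (i : ι) {f : (ι → ℝ) → E} {S : Set (ι → ℝ)}
    (hS : IsOpen S) (hf : ContDiffOn ℝ n f S) (hmn : m + 1 ≤ n) : ContDiffOn ℝ m (pd i f) S :=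
  fun _ hx => (contDiffAt_pd i (hf.contDiffAt (hS.mem_nhds hx)) hmn).contDiffWithinAt

end PartialDerivative

/-! ### Determinant and inverse of a matrix-valued function -/

section MatrixFunction

variable {ι : Type} [Fintype ι] [DecidableEq ι]
  {E : Type} [NormedAddCommGroup E] [NormedSpace ℝ E]

theorem contDiffOn_det {n : WithTop ℕ∞} {g : E → Matrix ι ι ℝ} {S : Set E}
    (hg : ∀ i j, ContDiffOn ℝ n (fun y => g y i j) S) :
    ContDiffOn ℝ n (fun y => (g y).det) S := by
  simp only [Matrix.det_apply']
  exact ContDiffOn.sum fun σ _ => contDiffOn_const.mul (contDiffOn_prod fun i _ => hg _ _)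

/-- Each entry of the adjugate is a determinant with one row replaced by a constant basis vector. -/
theorem contDiffOn_adjugate {n : WithTop ℕ∞} {g : E → Matrix ι ι ℝ} {S : Set E}
    (hg : ∀ i j, ContDiffOn ℝ n (fun y => g y i j) S) (i j : ι) :
    ContDiffOn ℝ n (fun y => (g y).adjugate i j) S := by
  simp only [Matrix.adjugate_apply]
  refine contDiffOn_det fun k l => ?_
  by_cases hk : k = j
  · subst hk; simpa using contDiffOn_const
  · simpa [Matrix.updateRow_ne hk] using hg k l

theorem contDiffOn_inv_apply {n : WithTop ℕ∞} {g : E → Matrix ι ι ℝ} {S : Set E}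
    (hg : ∀ i j, ContDiffOn ℝ n (fun y => g y i j) S) (hdet : ∀ y ∈ S, IsUnit (g y).det)
    (i j : ι) : ContDiffOn ℝ n (fun y => (g y)⁻¹ i j) S := by
  simp only [Matrix.inv_def, Ring.inverse_eq_inv', Matrix.smul_apply, smul_eq_mul]
  exact ((contDiffOn_det hg).inv fun y hy => (hdet y hy).ne_zero).mul (contDiffOn_adjugate hg i j)

/-- Jacobi's formula for the derivative of a determinant. -/
theorem hasDerivAt_det {g : ℝ → Matrix ι ι ℝ} {g' : Matrix ι ι ℝ} {s : ℝ}
    (hg : ∀ i j, HasDerivAt (fun r => g r i j) (g' i j) s) :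
    HasDerivAt (fun r => (g r).det) ((g s).adjugate * g').trace s := by
  have h : HasDerivAt (fun r => (g r).det) (∑ σ : Equiv.Perm ι, ((σ.sign : ℤ) : ℝ) *
      ∑ i, (∏ j ∈ Finset.univ.erase i, g s (σ j) j) * g' (σ i) i) s := by
    simp only [Matrix.det_apply']
    refine HasDerivAt.fun_sum fun σ _ => HasDerivAt.const_mul _ ?_
    simpa only [smul_eq_mul] using HasDerivAt.fun_finsetProd fun i _ => hg (σ i) i
  convert h using 1
  -- By Cramer's rule, each diagonal entry is the determinant with one column differentiated; the
  -- Leibniz expansion of the derivative is the sum of these.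
  have key : ∀ i, ((g s).adjugate * g') i i = ((g s).updateCol i fun k => g' k i).det := by
    intro i
    rw [← Matrix.cramer_apply, Matrix.cramer_eq_adjugate_mulVec]
    rfl
  simp only [Matrix.trace, Matrix.diag, key, Matrix.det_apply', Finset.mul_sum]
  rw [Finset.sum_comm]
  refine Finset.sum_congr rfl fun σ _ => Finset.sum_congr rfl fun i _ => ?_
  rw [← Finset.prod_erase_mul _ _ (Finset.mem_univ i), Matrix.updateCol_self]
  congr 2
  exact Finset.prod_congr rfl fun j hj => Matrix.updateCol_ne (Finset.ne_of_mem_erase hj)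

theorem deriv_log_det {g : ℝ → Matrix ι ι ℝ} {g' : Matrix ι ι ℝ} {s : ℝ}
    (hg : ∀ i j, HasDerivAt (fun r => g r i j) (g' i j) s) (hdet : IsUnit (g s).det) :
    deriv (fun r => Real.log (g r).det) s = ∑ i, ∑ j, (g s)⁻¹ i j * g' j i := by
  rw [((hasDerivAt_det hg).log hdet.ne_zero).deriv]
  simp only [Matrix.inv_def, Ring.inverse_eq_inv', Matrix.smul_apply, smul_eq_mul, Matrix.trace,
    Matrix.diag, Matrix.mul_apply, Finset.sum_div]
  exact Finset.sum_congr rfl fun i _ => Finset.sum_congr rfl fun j _ => by ring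

end MatrixFunction

/-! ### Metrics in a chart and their Christoffel symbols -/

section ChartMetric

variable {ι : Type} [Fintype ι] [DecidableEq ι]

/-- `g` is a smooth pseudo-Riemannian metric on the open set `S`. -/
structure ChartMetric (g : (ι → ℝ) → Matrix ι ι ℝ) (S : Set (ι → ℝ)) : Prop where
  isOpen : IsOpen S
  smooth : ∀ i j, ContDiffOn ℝ ∞ (fun y => g y i j) S
  symm : ∀ y ∈ S, ∀ i j, g y i j = g y j i
  isUnit_det : ∀ y ∈ S, IsUnit (g y).det

namespace ChartMetric

variable {g : (ι → ℝ) → Matrix ι ι ℝ} {S : Set (ι → ℝ)} (hg : ChartMetric g S)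
  {x : ι → ℝ} (hx : x ∈ S)

include hg

theorem smooth_inv (i j : ι) : ContDiffOn ℝ ∞ (fun y => (g y)⁻¹ i j) S :=
  contDiffOn_inv_apply hg.smooth hg.isUnit_det i j

theorem smooth_christoffel (k i j : ι) : ContDiffOn ℝ ∞ (christoffel g k i j) S := by
  have h : ∀ i j l, ContDiffOn ℝ ∞ (pd i fun y => g y j l) S := fun i j l =>
    contDiffOn_pd i hg.isOpen (hg.smooth j l) le_rfl
  exact contDiffOn_const.mul (ContDiffOn.sum fun l _ => (hg.smooth_inv k l).mul
    (((h i j l).add (h j i l)).sub (h l i j)))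

include hx

theorem differentiableAt (i j : ι) : DifferentiableAt ℝ (fun y => g y i j) x :=
  ((hg.smooth i j).contDiffAt (hg.isOpen.mem_nhds hx)).differentiableAt (by simp)

theorem differentiableAt_inv (i j : ι) : DifferentiableAt ℝ (fun y => (g y)⁻¹ i j) x :=
  ((hg.smooth_inv i j).contDiffAt (hg.isOpen.mem_nhds hx)).differentiableAt (by simp)

theorem differentiableAt_christoffel (k i j : ι) : DifferentiableAt ℝ (christoffel g k i j) x :=
  ((hg.smooth_christoffel k i j).contDiffAt (hg.isOpen.mem_nhds hx)).differentiableAt (by simp)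

theorem inv_symm (i j : ι) : (g x)⁻¹ i j = (g x)⁻¹ j i := by
  have h : (g x).transpose = g x := by
    ext i j; exact hg.symm x hx j i
  conv_lhs => rw [← h, ← Matrix.transpose_nonsing_inv]
  rfl

theorem pd_symm (k i j : ι) : pd k (fun y => g y i j) x = pd k (fun y => g y j i) x :=
  pd_congr_of_isOpen hg.isOpen hx k fun y hy => hg.symm y hy i j

theorem christoffel_symm (k i j : ι) : christoffel g k i j x = christoffel g k j i x := by
  simp only [christoffel, hg.pd_symm hx _ i j]
  congr 1
  exact Finset.sum_congr rfl fun l _ => by ring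

theorem sum_inv_mul (i j : ι) : ∑ k, (g x)⁻¹ i k * g x k j = if i = j then 1 else 0 := by
  rw [← Matrix.mul_apply, Matrix.nonsing_inv_mul _ (hg.isUnit_det x hx), Matrix.one_apply]

theorem sum_mul_inv (i j : ι) : ∑ k, g x i k * (g x)⁻¹ k j = if i = j then 1 else 0 := by
  rw [← Matrix.mul_apply, Matrix.mul_nonsing_inv _ (hg.isUnit_det x hx), Matrix.one_apply]

theorem sum_mul_christoffel (m i j : ι) :
    ∑ k, g x m k * christoffel g k i j x =
      (1 / 2) * (pd i (fun y => g y j m) x + pd j (fun y => g y i m) x -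
        pd m (fun y => g y i j) x) := by
  simp only [christoffel, Finset.mul_sum]
  rw [Finset.sum_comm]
  have h : ∀ l, ∑ k, g x m k * ((1 / 2) * ((g x)⁻¹ k l *
      (pd i (fun y => g y j l) x + pd j (fun y => g y i l) x - pd l (fun y => g y i j) x))) =
      (if m = l then 1 else 0) * ((1 / 2) *
      (pd i (fun y => g y j l) x + pd j (fun y => g y i l) x - pd l (fun y => g y i j) x)) := by
    intro l
    rw [← hg.sum_mul_inv hx, Finset.sum_mul]
    exact Finset.sum_congr rfl fun k _ => by ring
  simp only [h, ite_mul, one_mul, zero_mul, Finset.sum_ite_eq, Finset.mem_univ, if_true]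

/-- The Levi-Civita connection is compatible with the metric. -/
theorem pd_eq_sum_christoffel (k i j : ι) :
    pd k (fun y => g y i j) x =
      ∑ l, (g x j l * christoffel g l k i x + g x i l * christoffel g l k j x) := by
  rw [Finset.sum_add_distrib, hg.sum_mul_christoffel hx, hg.sum_mul_christoffel hx,
    hg.pd_symm hx _ j i, hg.pd_symm hx _ k j, hg.pd_symm hx _ k i]
  ring

/-- Covariant constancy of the inverse metric, obtained by differentiating `G⁻¹ G = 1` and inserting
metric compatibility in the matrix form `∂_k G = (G Γ)ᵀ + G Γ`. -/
theorem pd_inv (k i j : ι) :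
    pd k (fun y => (g y)⁻¹ i j) x =
      -∑ l, (christoffel g i k l x * (g x)⁻¹ l j + christoffel g j k l x * (g x)⁻¹ l i) := by
  set G := g x with hG
  let D : Matrix ι ι ℝ := Matrix.of fun i j => pd k (fun y => g y i j) x
  let D' : Matrix ι ι ℝ := Matrix.of fun i j => pd k (fun y => (g y)⁻¹ i j) x
  let Γ : Matrix ι ι ℝ := Matrix.of fun i j => christoffel g i k j x
  have hu := hg.isUnit_det x hx
  have h1 : D' * G + G⁻¹ * D = 0 := by
    ext i j
    have : pd k (fun y => ∑ l, (g y)⁻¹ i l * g y l j) x = 0 := by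
      rw [pd_congr_of_isOpen hg.isOpen hx k fun y hy => hg.sum_inv_mul hy i j, pd_const]
    rw [pd_sum _ _ fun l _ => (hg.differentiableAt_inv hx i l).fun_mul (hg.differentiableAt hx l j)]
      at this
    simp only [pd_mul k (hg.differentiableAt_inv hx _ _) (hg.differentiableAt hx _ _),
      Finset.sum_add_distrib] at this
    exact this
  have hGs : G.transpose = G := by ext i j; exact hg.symm x hx j i
  have h2 : D = (G * Γ).transpose + G * Γ := by
    ext i j
    simp only [D, Matrix.of_apply, hg.pd_eq_sum_christoffel hx, Finset.sum_add_distrib]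
    rfl
  have h3 : D' = -(G⁻¹ * Γ.transpose + Γ * G⁻¹) := by
    have h4 : D' = -(G⁻¹ * D * G⁻¹) := by
      have := congrArg (· * G⁻¹) h1
      simp only [add_mul, Matrix.mul_assoc, Matrix.mul_nonsing_inv G hu, zero_mul, mul_one] at this
      rw [eq_neg_of_add_eq_zero_left this, Matrix.mul_assoc]
    rw [h4, h2, Matrix.transpose_mul, hGs, mul_add, add_mul, ← Matrix.mul_assoc G⁻¹ G,
      Matrix.nonsing_inv_mul G hu, one_mul, Matrix.mul_assoc G⁻¹ (Γ.transpose * G),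
      Matrix.mul_assoc Γ.transpose, Matrix.mul_nonsing_inv G hu, mul_one]
  have h5 : D' i j = _ := congrFun (congrFun h3 i) j
  change D' i j = _
  rw [h5, Matrix.neg_apply, Matrix.add_apply, Matrix.mul_apply, Matrix.mul_apply,
    Finset.sum_add_distrib, add_comm]
  congr 2
  exact Finset.sum_congr rfl fun l _ => by
    rw [hg.inv_symm hx i l, mul_comm]; rfl

end ChartMetric

end ChartMetric

/-! ### Conformal change of the metric -/

noncomputable section Conformal

variable {ι : Type} [Fintype ι] [DecidableEq ι]

/-- The logarithmic derivative `ω_i = ∂_i Ω / Ω`. -/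
def pdLog (Ω : (ι → ℝ) → ℝ) (i : ι) (x : ι → ℝ) : ℝ := pd i Ω x / Ω x

/-- The vector field `ω^k = g^{kl} ∂_l Ω / Ω`. -/
def logGrad (g : (ι → ℝ) → Matrix ι ι ℝ) (Ω : (ι → ℝ) → ℝ) (k : ι) (x : ι → ℝ) : ℝ :=
  ∑ l, (g x)⁻¹ k l * pdLog Ω l x

/-- The covariant Hessian `∇_i ω_j` of `ln Ω`. -/
def logHess (g : (ι → ℝ) → Matrix ι ι ℝ) (Ω : (ι → ℝ) → ℝ) (i j : ι) (x : ι → ℝ) : ℝ :=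
  pd i (pdLog Ω j) x - ∑ k, christoffel g k i j x * pdLog Ω k x

/-- The Laplacian of `ln Ω`. -/
def logLaplacian (g : (ι → ℝ) → Matrix ι ι ℝ) (Ω : (ι → ℝ) → ℝ) (x : ι → ℝ) : ℝ :=
  ∑ i, ∑ j, (g x)⁻¹ i j * logHess g Ω i j x

/-- The squared norm `ω^k ω_k` of the differential of `ln Ω`. -/
def logGradSq (g : (ι → ℝ) → Matrix ι ι ℝ) (Ω : (ι → ℝ) → ℝ) (x : ι → ℝ) : ℝ :=
  ∑ k, pdLog Ω k x * logGrad g Ω k x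

/-- The difference `(1/2) (δ^k_i ω_j + δ^k_j ω_i - g_{ij} ω^k)` of the Christoffel symbols of
`Ω g` and `g`. -/
def conformalDiff (g : (ι → ℝ) → Matrix ι ι ℝ) (Ω : (ι → ℝ) → ℝ) (k i j : ι) (x : ι → ℝ) : ℝ :=
  (1 / 2) * ((if k = i then 1 else 0) * pdLog Ω j x +
    (if k = j then 1 else 0) * pdLog Ω i x - g x i j * logGrad g Ω k x)

/-- The contracted vector `Y` is left arbitrary so that it can be a row of Christoffel symbols, of
`conformalDiff` itself, of the metric, or `ω`. The same holds for the lower-index version below. -/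
theorem sum_conformalDiff_mul_upper (g : (ι → ℝ) → Matrix ι ι ℝ) (Ω : (ι → ℝ) → ℝ) (x : ι → ℝ)
    (i j : ι) (Y : ι → ℝ) :
    ∑ l, Y l * conformalDiff g Ω l i j x =
      (1 / 2) * (pdLog Ω j x * Y i + pdLog Ω i x * Y j -
        g x i j * ∑ l, logGrad g Ω l x * Y l) := by
  have h : ∀ l, Y l * conformalDiff g Ω l i j x =
      (1 / 2) * ((if l = i then Y l * pdLog Ω j x else 0) +
        (if l = j then Y l * pdLog Ω i x else 0) -
        g x i j * (logGrad g Ω l x * Y l)) := by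
    intro l; simp only [conformalDiff]; split_ifs <;> ring
  simp only [h, ← Finset.mul_sum, Finset.sum_sub_distrib, Finset.sum_add_distrib,
    Finset.sum_ite_eq', Finset.mem_univ, if_true]
  ring

theorem sum_conformalDiff_mul_lower (g : (ι → ℝ) → Matrix ι ι ℝ) (Ω : (ι → ℝ) → ℝ) (x : ι → ℝ)
    (k j : ι) (X : ι → ℝ) :
    ∑ l, conformalDiff g Ω k j l x * X l =
      (1 / 2) * ((if k = j then ∑ l, pdLog Ω l x * X l else 0) + pdLog Ω j x * X k -
        logGrad g Ω k x * ∑ l, g x j l * X l) := by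
  have h : ∀ l, conformalDiff g Ω k j l x * X l =
      (1 / 2) * ((if k = j then 1 else 0) * (pdLog Ω l x * X l) +
        (if k = l then pdLog Ω j x * X l else 0) -
        logGrad g Ω k x * (g x j l * X l)) := by
    intro l; simp only [conformalDiff]; split_ifs <;> ring
  simp only [h, ← Finset.mul_sum, Finset.sum_sub_distrib, Finset.sum_add_distrib,
    Finset.sum_ite_eq, Finset.mem_univ, if_true, ite_mul, one_mul, zero_mul]
  split_ifs <;> simp

namespace ChartMetric

variable {g : (ι → ℝ) → Matrix ι ι ℝ} {S : Set (ι → ℝ)} (hg : ChartMetric g S)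
  {Ω : (ι → ℝ) → ℝ} (hΩ : ContDiffOn ℝ ∞ Ω S) (hpos : ∀ y ∈ S, 0 < Ω y)
  {x : ι → ℝ} (hx : x ∈ S)

include hg

include hx

theorem sum_mul_logGrad (i : ι) : ∑ k, g x i k * logGrad g Ω k x = pdLog Ω i x := by
  simp only [logGrad, Finset.mul_sum]
  rw [Finset.sum_comm]
  simp only [← mul_assoc, ← Finset.sum_mul, hg.sum_mul_inv hx, ite_mul, one_mul, zero_mul,
    Finset.sum_ite_eq, Finset.mem_univ, if_true]

theorem sum_inv_mul_self : ∑ i, ∑ j, (g x)⁻¹ i j * g x i j = Fintype.card ι := by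
  have h : ∀ i, ∑ j, (g x)⁻¹ i j * g x i j = 1 := by
    intro i
    simp only [fun j => hg.symm x hx i j, hg.sum_inv_mul hx, if_true]
  simp [h]

theorem sum_conformalDiff (i : ι) :
    ∑ k, conformalDiff g Ω k i k x = (Fintype.card ι / 2) * pdLog Ω i x := by
  have h : ∀ k, conformalDiff g Ω k i k x =
      (1 / 2) * ((if k = i then pdLog Ω k x else 0) + pdLog Ω i x -
        g x i k * logGrad g Ω k x) := by
    intro k; simp only [conformalDiff]; split_ifs <;> simp
  simp only [h, ← Finset.mul_sum, Finset.sum_sub_distrib, Finset.sum_add_distrib,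
    Finset.sum_ite_eq', Finset.mem_univ, if_true, hg.sum_mul_logGrad hx]
  simp
  ring

theorem conformalDiff_symm (k i j : ι) :
    conformalDiff g Ω k i j x = conformalDiff g Ω k j i x := by
  simp only [conformalDiff, hg.symm x hx i j]; ring

include hpos in
theorem inv_smul : (Ω x • g x)⁻¹ = (Ω x)⁻¹ • (g x)⁻¹ := by
  apply Matrix.inv_eq_left_inv
  rw [Matrix.smul_mul, Matrix.mul_smul, smul_smul, inv_mul_cancel₀ (hpos x hx).ne', one_smul,
    Matrix.nonsing_inv_mul _ (hg.isUnit_det x hx)]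

include hΩ hpos

theorem christoffel_smul (k i j : ι) :
    christoffel (fun y => Ω y • g y) k i j x =
      christoffel g k i j x + conformalDiff g Ω k i j x := by
  have hΩx : DifferentiableAt ℝ Ω x :=
    (hΩ.contDiffAt (hg.isOpen.mem_nhds hx)).differentiableAt (by simp)
  have hne : Ω x ≠ 0 := (hpos x hx).ne'
  simp only [christoffel, hg.inv_smul hpos hx, Matrix.smul_apply, smul_eq_mul,
    pd_mul _ hΩx (hg.differentiableAt hx _ _)]
  have h : ∀ l, (Ω x)⁻¹ * (g x)⁻¹ k l *
      (pd i Ω x * g x j l + Ω x * pd i (fun y => g y j l) x +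
        (pd j Ω x * g x i l + Ω x * pd j (fun y => g y i l) x) -
        (pd l Ω x * g x i j + Ω x * pd l (fun y => g y i j) x)) =
      (g x)⁻¹ k l * (pd i (fun y => g y j l) x + pd j (fun y => g y i l) x -
        pd l (fun y => g y i j) x) +
      (pdLog Ω i x * ((g x)⁻¹ k l * g x l j) + pdLog Ω j x * ((g x)⁻¹ k l * g x l i) -
        g x i j * ((g x)⁻¹ k l * pdLog Ω l x)) := by
    intro l
    simp only [pdLog, hg.symm x hx l]
    field_simp
    ring
  simp only [h, Finset.sum_add_distrib, Finset.sum_sub_distrib, ← Finset.mul_sum,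
    hg.sum_inv_mul hx, conformalDiff, logGrad]
  ring

omit hpos hx in
theorem smooth_pdLog (hpos : ∀ y ∈ S, 0 < Ω y) (i : ι) :
    ContDiffOn ℝ ∞ (pdLog Ω i) S :=
  (contDiffOn_pd i hg.isOpen hΩ le_rfl).div hΩ fun y hy => (hpos y hy).ne'

theorem differentiableAt_pdLog (i : ι) : DifferentiableAt ℝ (pdLog Ω i) x :=
  ((hg.smooth_pdLog hΩ hpos i).contDiffAt (hg.isOpen.mem_nhds hx)).differentiableAt (by simp)

theorem differentiableAt_logGrad (k : ι) : DifferentiableAt ℝ (logGrad g Ω k) x :=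
  DifferentiableAt.fun_sum fun l _ =>
    (hg.differentiableAt_inv hx k l).mul (hg.differentiableAt_pdLog hΩ hpos hx l)

theorem differentiableAt_conformalDiff (k i j : ι) :
    DifferentiableAt ℝ (conformalDiff g Ω k i j) x :=
  (differentiableAt_const _).mul
    ((((differentiableAt_const _).mul (hg.differentiableAt_pdLog hΩ hpos hx j)).add
      ((differentiableAt_const _).mul (hg.differentiableAt_pdLog hΩ hpos hx i))).sub
      ((hg.differentiableAt hx i j).mul (hg.differentiableAt_logGrad hΩ hpos hx k)))

theorem pd_conformalDiff (l k i j : ι) :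
    pd l (conformalDiff g Ω k i j) x =
      (1 / 2) * ((if k = i then 1 else 0) * pd l (pdLog Ω j) x +
        (if k = j then 1 else 0) * pd l (pdLog Ω i) x -
        (pd l (fun y => g y i j) x * logGrad g Ω k x + g x i j * pd l (logGrad g Ω k) x)) := by
  have hi := hg.differentiableAt_pdLog hΩ hpos hx i
  have hj := hg.differentiableAt_pdLog hΩ hpos hx j
  have hk := hg.differentiableAt_logGrad hΩ hpos hx k
  have hij := hg.differentiableAt hx i j
  rw [show conformalDiff g Ω k i j = fun y => (1 / 2) * ((if k = i then 1 else 0) *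
    pdLog Ω j y + (if k = j then 1 else 0) * pdLog Ω i y - g y i j * logGrad g Ω k y)
    from rfl]
  rw [pd_const_mul _ _ (((hj.const_mul _).fun_add (hi.const_mul _)).fun_sub (hij.fun_mul hk)),
    pd_sub _ ((hj.const_mul _).fun_add (hi.const_mul _)) (hij.fun_mul hk),
    pd_add _ (hj.const_mul _) (hi.const_mul _), pd_const_mul _ _ hj, pd_const_mul _ _ hi,
    pd_mul _ hij hk]

/-- The coordinate form of `div (grad ln Ω) = Δ ln Ω`: the derivatives falling on the inverse metric
are traded for Christoffel symbols by `pd_inv`. -/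
theorem sum_pd_logGrad :
    ∑ k, pd k (logGrad g Ω k) x =
      logLaplacian g Ω x - ∑ k, ∑ l, christoffel g k k l x * logGrad g Ω l x := by
  have h : ∀ k, pd k (logGrad g Ω k) x = ∑ m, ((g x)⁻¹ k m * pd k (pdLog Ω m) x -
      ∑ l, (christoffel g k k l x * (g x)⁻¹ l m + christoffel g m k l x * (g x)⁻¹ l k) *
        pdLog Ω m x) := by
    intro k
    rw [show logGrad g Ω k = fun y => ∑ m, (g y)⁻¹ k m * pdLog Ω m y from rfl,
      pd_sum _ _ fun m _ => (hg.differentiableAt_inv hx k m).fun_mul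
        (hg.differentiableAt_pdLog hΩ hpos hx m)]
    refine Finset.sum_congr rfl fun m _ => ?_
    rw [pd_mul _ (hg.differentiableAt_inv hx k m) (hg.differentiableAt_pdLog hΩ hpos hx m),
      hg.pd_inv hx, ← Finset.sum_mul]
    ring
  have h1 : ∀ k, ∑ m, ∑ l, christoffel g k k l x * (g x)⁻¹ l m * pdLog Ω m x =
      ∑ l, christoffel g k k l x * logGrad g Ω l x := by
    intro k
    rw [Finset.sum_comm]
    simp only [logGrad, Finset.mul_sum, mul_assoc]
  have h2 : ∀ k, ∑ m, ∑ l, christoffel g m k l x * (g x)⁻¹ l k * pdLog Ω m x =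
      ∑ l, (g x)⁻¹ k l * ∑ m, christoffel g m k l x * pdLog Ω m x := by
    intro k
    rw [Finset.sum_comm]
    simp only [Finset.mul_sum]
    refine Finset.sum_congr rfl fun l _ => Finset.sum_congr rfl fun m _ => ?_
    rw [hg.inv_symm hx k l]; ring
  simp only [h, logLaplacian, logHess, Finset.sum_sub_distrib, add_mul, Finset.sum_add_distrib,
    h1, h2, mul_sub]
  ring

/-- Substituting `Γ + C` in the Ricci tensor, with `C` the conformal difference, gives terms in
`∂C`, `ΓC`, `CΓ` and `CC`, contracted separately in `s1` to `s8`. The two orders of indices of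
`logHess` are kept apart: symmetry of second derivatives is not needed, because only the trace
against the symmetric inverse metric is used later. -/
theorem ricci_smul (i j : ι) :
    ricci (fun y => Ω y • g y) i j x =
      ricci g i j x + (1 / 2) * (logHess g Ω i j x + logHess g Ω j i x -
        g x i j * logLaplacian g Ω x) - (Fintype.card ι / 2) * logHess g Ω j i x +
      ((Fintype.card ι - 2) / 4) * (pdLog Ω i x * pdLog Ω j x -
        g x i j * logGradSq g Ω x) := by
  have hpd : ∀ l k i j, pd l (christoffel (fun y => Ω y • g y) k i j) x =
      pd l (christoffel g k i j) x + pd l (conformalDiff g Ω k i j) x := by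
    intro l k i j
    rw [pd_congr_of_isOpen hg.isOpen hx l fun y hy => hg.christoffel_smul hΩ hpos hy k i j,
      pd_add l (hg.differentiableAt_christoffel hx k i j)
        (hg.differentiableAt_conformalDiff hΩ hpos hx k i j)]
  have s1 : ∑ k, pd k (conformalDiff g Ω k i j) x =
      (1 / 2) * (pd i (pdLog Ω j) x + pd j (pdLog Ω i) x -
        (∑ k, pd k (fun y => g y i j) x * logGrad g Ω k x + g x i j * ∑ k, pd k (logGrad g Ω k) x))
      := by
    simp only [hg.pd_conformalDiff hΩ hpos hx, ← Finset.mul_sum, Finset.sum_sub_distrib,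
      Finset.sum_add_distrib, ite_mul, one_mul, zero_mul, Finset.sum_ite_eq', Finset.mem_univ,
      if_true]
  have s2 : ∑ k, pd j (conformalDiff g Ω k i k) x =
      (Fintype.card ι / 2) * pd j (pdLog Ω i) x := by
    rw [← pd_const_mul _ _ (hg.differentiableAt_pdLog hΩ hpos hx i),
      ← pd_sum _ _ fun k _ => hg.differentiableAt_conformalDiff hΩ hpos hx k i k]
    exact pd_congr_of_isOpen hg.isOpen hx j fun y hy => hg.sum_conformalDiff hy i
  have s3 : ∑ k, ∑ l, christoffel g k k l x * conformalDiff g Ω l i j x =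
      (1 / 2) * (pdLog Ω j x * ∑ k, christoffel g k i k x +
        pdLog Ω i x * ∑ k, christoffel g k j k x -
        g x i j * ∑ k, ∑ l, christoffel g k k l x * logGrad g Ω l x) := by
    simp only [sum_conformalDiff_mul_upper, ← Finset.mul_sum, Finset.sum_sub_distrib,
      Finset.sum_add_distrib, hg.christoffel_symm hx _ _ i, hg.christoffel_symm hx _ _ j,
      mul_comm (logGrad g Ω _ x)]
  have s4 : ∀ X : ι → ℝ, ∑ k, ∑ l, conformalDiff g Ω k k l x * X l =
      (Fintype.card ι / 2) * ∑ l, X l * pdLog Ω l x := by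
    intro X
    rw [Finset.sum_comm]
    simp only [← Finset.sum_mul, Finset.mul_sum]
    refine Finset.sum_congr rfl fun l _ => ?_
    rw [Finset.sum_congr rfl fun k _ => hg.conformalDiff_symm hx k k l, hg.sum_conformalDiff hx]
    ring
  have s5 : ∑ k, ∑ l, conformalDiff g Ω k k l x * conformalDiff g Ω l i j x =
      (Fintype.card ι / 2) * ((1 / 2) * (2 * (pdLog Ω i x * pdLog Ω j x) -
        g x i j * logGradSq g Ω x)) := by
    rw [s4]
    congr 1
    simp only [mul_comm (conformalDiff g Ω _ i j x), sum_conformalDiff_mul_upper, logGradSq,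
      mul_comm (logGrad g Ω _ x)]
    ring
  have s6 : ∑ k, ∑ l, christoffel g k j l x * conformalDiff g Ω l i k x =
      (1 / 2) * (∑ k, christoffel g k i j x * pdLog Ω k x +
        pdLog Ω i x * ∑ k, christoffel g k j k x -
        ∑ k, ∑ l, g x i k * christoffel g k j l x * logGrad g Ω l x) := by
    have e : ∑ k, ∑ l, g x i k * christoffel g k j l x * logGrad g Ω l x =
        ∑ k, g x i k * ∑ l, logGrad g Ω l x * christoffel g k j l x := by
      simp only [Finset.mul_sum]
      exact Finset.sum_congr rfl fun k _ => Finset.sum_congr rfl fun l _ => by ring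
    simp only [e, sum_conformalDiff_mul_upper, ← Finset.mul_sum, ← Finset.sum_mul, Finset.sum_sub_distrib,
      Finset.sum_add_distrib, hg.christoffel_symm hx _ j i, mul_comm (pdLog Ω _ x)]
  have s7 : ∑ k, ∑ l, conformalDiff g Ω k j l x * christoffel g l i k x =
      (1 / 2) * (∑ k, christoffel g k i j x * pdLog Ω k x +
        pdLog Ω j x * ∑ k, christoffel g k i k x -
        ∑ k, ∑ l, g x j k * christoffel g k i l x * logGrad g Ω l x) := by
    have e : ∑ k, ∑ l, g x j k * christoffel g k i l x * logGrad g Ω l x =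
        ∑ k, logGrad g Ω k x * ∑ l, g x j l * christoffel g l i k x := by
      rw [Finset.sum_comm]
      simp only [Finset.mul_sum]
      exact Finset.sum_congr rfl fun k _ => Finset.sum_congr rfl fun l _ => by ring
    simp only [e, sum_conformalDiff_mul_lower, ← Finset.mul_sum, ← Finset.sum_mul, Finset.sum_sub_distrib,
      Finset.sum_add_distrib, Finset.sum_ite_eq', Finset.mem_univ, if_true,
      mul_comm (pdLog Ω _ x)]
  have hup : ∀ i k, ∑ l, pdLog Ω l x * conformalDiff g Ω l i k x =
      pdLog Ω i x * pdLog Ω k x - (1 / 2) * (g x i k * logGradSq g Ω x) := by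
    intro i k
    simp only [sum_conformalDiff_mul_upper, logGradSq, mul_comm (logGrad g Ω _ x)]
    ring
  have hlow : ∀ k, ∑ l, g x j l * conformalDiff g Ω l i k x =
      (1 / 2) * (g x i j * pdLog Ω k x + g x j k * pdLog Ω i x -
        g x i k * pdLog Ω j x) := by
    intro k
    simp only [sum_conformalDiff_mul_upper, mul_comm (logGrad g Ω _ x), hg.sum_mul_logGrad hx,
      hg.symm x hx j i]
    ring
  have s8 : ∑ k, ∑ l, conformalDiff g Ω k j l x * conformalDiff g Ω l i k x =
      (1 / 4) * ((Fintype.card ι + 2) * (pdLog Ω i x * pdLog Ω j x) -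
        2 * (g x i j * logGradSq g Ω x)) := by
    have e : ∀ k, ∑ l, conformalDiff g Ω k j l x * conformalDiff g Ω l i k x =
        (1 / 2) * ((if k = j then pdLog Ω i x * pdLog Ω k x -
            (1 / 2) * (g x i k * logGradSq g Ω x) else 0) +
          pdLog Ω j x * conformalDiff g Ω k i k x -
          (1 / 2) * (g x i j * (pdLog Ω k x * logGrad g Ω k x) +
            pdLog Ω i x * (g x j k * logGrad g Ω k x) -
            pdLog Ω j x * (g x i k * logGrad g Ω k x))) := by
      intro k
      rw [sum_conformalDiff_mul_lower, hup, hlow]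
      ring
    have hsq : ∑ k, pdLog Ω k x * logGrad g Ω k x = logGradSq g Ω x := rfl
    simp only [e, ← Finset.mul_sum, Finset.sum_sub_distrib, Finset.sum_add_distrib,
      Finset.sum_ite_eq', Finset.mem_univ, if_true, hg.sum_conformalDiff hx, hsq,
      hg.sum_mul_logGrad hx]
    ring
  -- Metric compatibility makes the non-tensorial term `∂_k g_{ij} ω^k` of `s1` cancel against the
  -- last terms of `s6` and `s7`.
  have hcompat : ∑ k, pd k (fun y => g y i j) x * logGrad g Ω k x =
      ∑ k, ∑ l, g x j k * christoffel g k i l x * logGrad g Ω l x +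
      ∑ k, ∑ l, g x i k * christoffel g k j l x * logGrad g Ω l x := by
    rw [Finset.sum_comm, Finset.sum_comm (f := fun k l => g x i k * _ * _),
      ← Finset.sum_add_distrib]
    refine Finset.sum_congr rfl fun k _ => ?_
    rw [hg.pd_eq_sum_christoffel hx, Finset.sum_mul, ← Finset.sum_add_distrib]
    refine Finset.sum_congr rfl fun l _ => ?_
    rw [hg.christoffel_symm hx l k i, hg.christoffel_symm hx l k j]
    ring
  have hN : ∀ i j, logHess g Ω i j x =
      pd i (pdLog Ω j) x - ∑ k, christoffel g k i j x * pdLog Ω k x := fun _ _ => rfl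
  simp only [ricci, hpd, hg.christoffel_smul hΩ hpos hx, add_mul, mul_add, Finset.sum_add_distrib,
    Finset.sum_sub_distrib, s1, s2, s3, s4 fun l => christoffel g l i j x, s5, s6, s7, s8, hcompat,
    hN, hg.christoffel_symm hx _ j i, hg.sum_pd_logGrad hΩ hpos hx]
  ring

end ChartMetric

end Conformal

/-! ### Conformal change of scalar curvature, Laplacian and Yamabe operator -/

section ConformalCovariance

variable {ι : Type} [Fintype ι] [DecidableEq ι]

namespace ChartMetric

variable {g : (ι → ℝ) → Matrix ι ι ℝ} {S : Set (ι → ℝ)} (hg : ChartMetric g S)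
  {Ω : (ι → ℝ) → ℝ} (hΩ : ContDiffOn ℝ ∞ Ω S) (hpos : ∀ y ∈ S, 0 < Ω y)
  {x : ι → ℝ} (hx : x ∈ S)

include hg hx

theorem sum_inv_mul_pdLog :
    ∑ i, ∑ j, (g x)⁻¹ i j * (pdLog Ω i x * pdLog Ω j x) = logGradSq g Ω x := by
  simp only [logGradSq, logGrad, Finset.mul_sum]
  exact Finset.sum_congr rfl fun i _ => Finset.sum_congr rfl fun j _ => by ring

theorem sum_inv_mul_swap (X : ι → ι → ℝ) :
    ∑ i, ∑ j, (g x)⁻¹ i j * X j i = ∑ i, ∑ j, (g x)⁻¹ i j * X i j := by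
  rw [Finset.sum_comm]
  exact Finset.sum_congr rfl fun i _ => Finset.sum_congr rfl fun j _ => by
    rw [hg.inv_symm hx]

theorem sum_inv_mul_conformalDiff (k : ι) :
    ∑ i, ∑ j, (g x)⁻¹ i j * conformalDiff g Ω k i j x =
      -((Fintype.card ι - 2) / 2) * logGrad g Ω k x := by
  have h : ∀ i j, (g x)⁻¹ i j * conformalDiff g Ω k i j x =
      (1 / 2) * ((if k = i then (g x)⁻¹ i j * pdLog Ω j x else 0) +
        (if k = j then (g x)⁻¹ i j * pdLog Ω i x else 0) -
        ((g x)⁻¹ i j * g x i j) * logGrad g Ω k x) := by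
    intro i j; simp only [conformalDiff]; split_ifs <;> ring
  have h1 : ∑ i, ∑ j, (if k = i then (g x)⁻¹ i j * pdLog Ω j x else 0) =
      logGrad g Ω k x := by
    rw [Finset.sum_comm]
    simp [logGrad]
  have h2 : ∑ i, ∑ j, (if k = j then (g x)⁻¹ i j * pdLog Ω i x else 0) =
      logGrad g Ω k x := by
    simp [logGrad, hg.inv_symm hx k]
  simp only [h, ← Finset.mul_sum, Finset.sum_sub_distrib, Finset.sum_add_distrib, h1, h2,
    ← Finset.sum_mul, hg.sum_inv_mul_self hx]
  ring

include hΩ hpos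

theorem scalarCurvature_smul :
    scalarCurvature (fun y => Ω y • g y) x =
      (Ω x)⁻¹ * (scalarCurvature g x - (Fintype.card ι - 1) * logLaplacian g Ω x -
        (Fintype.card ι - 1) * (Fintype.card ι - 2) / 4 * logGradSq g Ω x) := by
  have h : ∀ i j, (Ω x • g x)⁻¹ i j * ricci (fun y => Ω y • g y) i j x =
      (Ω x)⁻¹ * ((g x)⁻¹ i j * ricci g i j x +
        (1 / 2) * ((g x)⁻¹ i j * logHess g Ω i j x + (g x)⁻¹ i j * logHess g Ω j i x -
          ((g x)⁻¹ i j * g x i j) * logLaplacian g Ω x) -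
        (Fintype.card ι / 2) * ((g x)⁻¹ i j * logHess g Ω j i x) +
        ((Fintype.card ι - 2) / 4) * ((g x)⁻¹ i j * (pdLog Ω i x * pdLog Ω j x) -
          ((g x)⁻¹ i j * g x i j) * logGradSq g Ω x)) := by
    intro i j
    rw [hg.inv_smul hpos hx, hg.ricci_smul hΩ hpos hx, Matrix.smul_apply, smul_eq_mul]
    ring
  have hT : ∑ i, ∑ j, (g x)⁻¹ i j * logHess g Ω i j x = logLaplacian g Ω x := rfl
  simp only [scalarCurvature, h, ← Finset.mul_sum, Finset.sum_sub_distrib, Finset.sum_add_distrib,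
    ← Finset.sum_mul, hg.sum_inv_mul_self hx, hg.sum_inv_mul_pdLog hx,
    hg.sum_inv_mul_swap hx fun i j => logHess g Ω i j x, hT]
  ring

/-- Conjugation by `Ω^s` turns `∂_i` into `∂_i + s ω_i`. The result is again `Ω^s` times a function,
so the rule can be iterated for second derivatives. -/
theorem pd_rpow_mul (s : ℝ) (i : ι) {f : (ι → ℝ) → ℂ} (hf : DifferentiableAt ℝ f x) :
    pd i (fun y => ((Ω y ^ s : ℝ) : ℂ) * f y) x =
      ((Ω x ^ s : ℝ) : ℂ) * (pd i f x + s * (pdLog Ω i x : ℂ) * f x) := by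
  have hΩx : DifferentiableAt ℝ Ω x :=
    (hΩ.contDiffAt (hg.isOpen.mem_nhds hx)).differentiableAt (by simp)
  have hr : DifferentiableAt ℝ (fun y => Ω y ^ s) x :=
    hΩx.rpow_const (Or.inl (hpos x hx).ne')
  have hc : DifferentiableAt ℝ (fun y => ((Ω y ^ s : ℝ) : ℂ)) x :=
    Complex.ofRealCLM.differentiableAt.comp x hr
  have hd : pd i (fun y => Ω y ^ s) x = Ω x ^ s * (s * pdLog Ω i x) := by
    rw [pd_comp_hasDerivAt i hΩx (Real.hasDerivAt_rpow_const (Or.inl (hpos x hx).ne')),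
      Real.rpow_sub_one (hpos x hx).ne', pdLog]
    ring
  rw [pd_mul i hc hf, pd_ofReal i hr, hd]
  push_cast
  ring

theorem laplaceBeltrami_smul {s : ℝ} (hs : s = -((Fintype.card ι - 2) / 4)) {f : (ι → ℝ) → ℂ}
    (hf : ContDiffOn ℝ 2 f S) :
    laplaceBeltrami (fun y => Ω y • g y) (fun y => ((Ω y ^ s : ℝ) : ℂ) * f y) x =
      ((Ω x ^ (s - 1) : ℝ) : ℂ) * (laplaceBeltrami g f x +
        ((s * logLaplacian g Ω x - s ^ 2 * logGradSq g Ω x : ℝ) : ℂ) * f x) := by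
  have hf1 : ∀ y ∈ S, DifferentiableAt ℝ f y := fun y hy =>
    (hf.contDiffAt (hg.isOpen.mem_nhds hy)).differentiableAt (by simp)
  have hf2 : ∀ j, DifferentiableAt ℝ (pd j f) x := fun j =>
    ((contDiffOn_pd (m := 1) j hg.isOpen hf (by norm_num)).contDiffAt
      (hg.isOpen.mem_nhds hx)).differentiableAt (by simp)
  have hω : ∀ j, DifferentiableAt ℝ (fun y => (pdLog Ω j y : ℂ)) x := fun j =>
    Complex.ofRealCLM.differentiableAt.comp x (hg.differentiableAt_pdLog hΩ hpos hx j)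
  have hsω : ∀ j, DifferentiableAt ℝ (fun y => (s : ℂ) * (pdLog Ω j y : ℂ)) x := fun j =>
    (hω j).const_mul _
  have hpp : ∀ i j, pd i (pd j fun y => ((Ω y ^ s : ℝ) : ℂ) * f y) x =
      ((Ω x ^ s : ℝ) : ℂ) * (pd i (pd j f) x + (s * (pd i (pdLog Ω j) x : ℝ) * f x +
        s * (pdLog Ω j x : ℂ) * pd i f x) +
        s * (pdLog Ω i x : ℂ) * (pd j f x + s * (pdLog Ω j x : ℂ) * f x)) := by
    intro i j
    rw [pd_congr_of_isOpen hg.isOpen hx i fun y hy =>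
        hg.pd_rpow_mul hΩ hpos hy s j (hf1 y hy),
      hg.pd_rpow_mul hΩ hpos hx s i ((hf2 j).fun_add ((hsω j).fun_mul (hf1 x hx))),
      pd_add i (hf2 j) ((hsω j).fun_mul (hf1 x hx)), pd_mul i (hsω j) (hf1 x hx),
      pd_const_mul i _ (hω j), pd_ofReal i (hg.differentiableAt_pdLog hΩ hpos hx j)]
  have hW : ((Ω x ^ (s - 1) : ℝ) : ℂ) = ((Ω x ^ s : ℝ) : ℂ) * ((Ω x)⁻¹ : ℝ) := by
    rw [Real.rpow_sub_one (hpos x hx).ne', div_eq_mul_inv, Complex.ofReal_mul]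
  have hterm : ∀ i j, ((((Ω x • g x)⁻¹ i j : ℝ)) : ℂ) *
      (pd i (pd j fun y => ((Ω y ^ s : ℝ) : ℂ) * f y) x -
        ∑ k, (christoffel (fun y => Ω y • g y) k i j x : ℂ) *
          pd k (fun y => ((Ω y ^ s : ℝ) : ℂ) * f y) x) =
      ((Ω x ^ (s - 1) : ℝ) : ℂ) * ((((g x)⁻¹ i j : ℝ) : ℂ) *
          (pd i (pd j f) x - ∑ k, (christoffel g k i j x : ℂ) * pd k f x) +
        (s * f x) * (((g x)⁻¹ i j * logHess g Ω i j x : ℝ) : ℂ) +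
        s * (((g x)⁻¹ i j * pdLog Ω i x : ℝ) * pd j f x) +
        s * (((g x)⁻¹ i j * pdLog Ω j x : ℝ) * pd i f x) +
        (s ^ 2 * f x) * (((g x)⁻¹ i j * (pdLog Ω i x * pdLog Ω j x) : ℝ) : ℂ) -
        ∑ k, (((g x)⁻¹ i j * conformalDiff g Ω k i j x : ℝ) : ℂ) *
          (pd k f x + s * (pdLog Ω k x : ℂ) * f x)) := by
    intro i j
    have hsum : ∑ k, (christoffel (fun y => Ω y • g y) k i j x : ℂ) *
          pd k (fun y => ((Ω y ^ s : ℝ) : ℂ) * f y) x =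
        ((Ω x ^ s : ℝ) : ℂ) * (∑ k, (christoffel g k i j x : ℂ) * pd k f x +
          s * f x * ∑ k, ((christoffel g k i j x * pdLog Ω k x : ℝ) : ℂ) +
          ∑ k, (conformalDiff g Ω k i j x : ℂ) * (pd k f x + s * (pdLog Ω k x : ℂ) * f x)) := by
      simp only [Finset.mul_sum, ← Finset.sum_add_distrib]
      refine Finset.sum_congr rfl fun k _ => ?_
      rw [hg.christoffel_smul hΩ hpos hx, hg.pd_rpow_mul hΩ hpos hx s k (hf1 x hx)]
      push_cast
      ring
    have hC : ∑ k, (((g x)⁻¹ i j * conformalDiff g Ω k i j x : ℝ) : ℂ) *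
          (pd k f x + s * (pdLog Ω k x : ℂ) * f x) = (((g x)⁻¹ i j : ℝ) : ℂ) *
        ∑ k, (conformalDiff g Ω k i j x : ℂ) * (pd k f x + s * (pdLog Ω k x : ℂ) * f x) := by
      simp only [Finset.mul_sum, Complex.ofReal_mul, mul_assoc]
    rw [hpp, hsum, hC, hW, hg.inv_smul hpos hx, Matrix.smul_apply, smul_eq_mul, logHess]
    push_cast
    ring
  have e1 : ∑ i, ∑ j, (((g x)⁻¹ i j * logHess g Ω i j x : ℝ) : ℂ) = (logLaplacian g Ω x : ℂ) := by
    simp only [logLaplacian, Complex.ofReal_sum]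
  have e2 : ∑ i, ∑ j, (((g x)⁻¹ i j * pdLog Ω j x : ℝ) : ℂ) * pd i f x =
      ∑ k, (logGrad g Ω k x : ℂ) * pd k f x := by
    simp only [logGrad, Complex.ofReal_sum, Finset.sum_mul]
  have e3 : ∑ i, ∑ j, (((g x)⁻¹ i j * pdLog Ω i x : ℝ) : ℂ) * pd j f x =
      ∑ k, (logGrad g Ω k x : ℂ) * pd k f x := by
    rw [Finset.sum_comm, ← e2]
    exact Finset.sum_congr rfl fun i _ => Finset.sum_congr rfl fun j _ => by
      rw [hg.inv_symm hx]
  have e4 : ∑ i, ∑ j, (((g x)⁻¹ i j * (pdLog Ω i x * pdLog Ω j x) : ℝ) : ℂ) =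
      (logGradSq g Ω x : ℂ) := by
    simp only [← hg.sum_inv_mul_pdLog hx, Complex.ofReal_sum]
  -- The choice of `s` enters here: the trace `-((n-2)/2) ω^k` of the conformal difference equals `2
  -- s ω^k`, which cancels the two cross terms `s ω^k ∂_k f` of `e2` and `e3` and turns the
  -- coefficient `s²` of `|ω|²` into `-s²`.
  have e5 : ∑ i, ∑ j, ∑ k, (((g x)⁻¹ i j * conformalDiff g Ω k i j x : ℝ) : ℂ) *
      (pd k f x + s * (pdLog Ω k x : ℂ) * f x) =
      2 * s * (∑ k, (logGrad g Ω k x : ℂ) * pd k f x + s * f x * logGradSq g Ω x) := by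
    have h : ∀ k, ∑ i, ∑ j, (((g x)⁻¹ i j * conformalDiff g Ω k i j x : ℝ) : ℂ) =
        2 * s * (logGrad g Ω k x : ℂ) := by
      intro k
      have := congrArg (Complex.ofReal) (hg.sum_inv_mul_conformalDiff (Ω := Ω) hx k)
      simp only [Complex.ofReal_sum] at this
      rw [this, hs]
      push_cast
      ring
    simp only [fun i => Finset.sum_comm (s := Finset.univ) (t := Finset.univ)
      (f := fun j k => (((g x)⁻¹ i j * conformalDiff g Ω k i j x : ℝ) : ℂ) *
      (pd k f x + s * (pdLog Ω k x : ℂ) * f x))]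
    rw [Finset.sum_comm]
    simp only [← Finset.sum_mul, h, logGradSq, Complex.ofReal_sum, Finset.mul_sum,
      ← Finset.sum_add_distrib]
    refine Finset.sum_congr rfl fun k _ => ?_
    push_cast
    ring
  simp only [laplaceBeltrami, hterm]
  simp only [← Finset.mul_sum, Finset.sum_sub_distrib, Finset.sum_add_distrib, e1, e2, e3, e4, e5]
  push_cast
  ring

/-- Conformal covariance of the Yamabe operator. -/
theorem yamabe_smul {s : ℝ} (hs : s = -((Fintype.card ι - 2) / 4))
    (hcard : (Fintype.card ι : ℝ) ≠ 1) {f : (ι → ℝ) → ℂ} (hf : ContDiffOn ℝ 2 f S) :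
    yamabe (fun y => Ω y • g y) (fun y => ((Ω y ^ s : ℝ) : ℂ) * f y) x =
      ((Ω x ^ (s - 1) : ℝ) : ℂ) * yamabe g f x := by
  have hne : (Fintype.card ι : ℝ) - 1 ≠ 0 := sub_ne_zero.mpr hcard
  -- The excess on the right is exactly the potential produced by `laplaceBeltrami_smul`, so the two
  -- cancel in the difference. Clearing the factor `n - 1` requires `n ≠ 1`.
  have hR : (((Fintype.card ι : ℝ) - 2) / (4 * ((Fintype.card ι : ℝ) - 1)) *
      scalarCurvature (fun y => Ω y • g y) x) * Ω x ^ s = Ω x ^ (s - 1) *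
      (((Fintype.card ι : ℝ) - 2) / (4 * ((Fintype.card ι : ℝ) - 1)) * scalarCurvature g x +
        (s * logLaplacian g Ω x - s ^ 2 * logGradSq g Ω x)) := by
    rw [hg.scalarCurvature_smul hΩ hpos hx, Real.rpow_sub_one (hpos x hx).ne', hs]
    field_simp
    ring
  simp only [yamabe, hg.laplaceBeltrami_smul hΩ hpos hx hs hf, ← mul_assoc]
  rw [← Complex.ofReal_mul, hR]
  push_cast
  ring

end ChartMetric

end ConformalCovariance

/-! ### The Bargmann metric -/

section PartialDerivativeUpdate

variable {ι : Type} [Fintype ι] [DecidableEq ι]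
  {E : Type} [NormedAddCommGroup E] [NormedSpace ℝ E]

theorem pd_eq_deriv_update (i : ι) {f : (ι → ℝ) → E} {x : ι → ℝ} (hf : DifferentiableAt ℝ f x) :
    pd i f x = deriv (fun s => f (Function.update x i s)) (x i) := by
  have hf' : DifferentiableAt ℝ f (Function.update x i (x i)) := by
    rwa [Function.update_eq_self]
  have := (hf'.hasFDerivAt.comp_hasDerivAt (x i) (hasDerivAt_update x i (x i))).deriv
  rw [Function.update_eq_self] at this
  exact this.symm

end PartialDerivativeUpdate

/-! ### Coordinates `(u, t, x)`, translations in `u`, and the chart -/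

namespace PlatonicWave

variable {d : ℕ}

theorem sum_waveIndex {M : Type*} [AddCommMonoid M] (F : WaveIndex d → M) :
    ∑ a, F a = F .u + (F .t + ∑ i, F (.x i)) := by
  rw [← Equiv.sum_comp (waveIndexEquiv d).symm F, Fintype.sum_option, Fintype.sum_option]
  rfl

theorem card_waveIndex : Fintype.card (WaveIndex d) = d + 2 := by
  simp [Fintype.card_congr (waveIndexEquiv d)]

theorem contDiff_base {n : WithTop ℕ∞} : ContDiff ℝ n (base : (WaveIndex d → ℝ) → _) :=
  (contDiff_apply ℝ ℝ _).prodMk (contDiff_pi.mpr fun _ => contDiff_apply ℝ ℝ _)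

/-- The point with the `(u, t)` coordinates of `p` and spatial coordinates `y`. -/
def slice (p : WaveIndex d → ℝ) (y : Fin d → ℝ) : WaveIndex d → ℝ
  | .u => p .u
  | .t => p .t
  | .x i => y i

theorem contDiff_slice {n : WithTop ℕ∞} (p : WaveIndex d → ℝ) : ContDiff ℝ n (slice p) := by
  refine contDiff_pi.mpr fun a => ?_
  cases a
  · exact contDiff_const
  · exact contDiff_const
  · exact contDiff_apply ℝ ℝ _

theorem slice_self (p : WaveIndex d → ℝ) : slice p (base p).2 = p := by
  funext a; cases a <;> rfl

theorem base_update_u (p : WaveIndex d → ℝ) (s : ℝ) :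
    base (Function.update p .u s) = base p := rfl

theorem base_update_t (p : WaveIndex d → ℝ) (s : ℝ) :
    base (Function.update p .t s) = (s, (base p).2) := rfl

theorem update_x (p : WaveIndex d → ℝ) (k : Fin d) (s : ℝ) :
    Function.update p (.x k) s = slice p (Function.update (base p).2 k s) := by
  funext a
  cases a with
  | u => rfl
  | t => rfl
  | x i =>
    by_cases h : i = k
    · subst h; simp [slice]
    · have : (WaveIndex.x i : WaveIndex d) ≠ .x k := fun e => h (WaveIndex.x.inj e)
      simp [slice, h, this, base]

variable {E : Type} [NormedAddCommGroup E] [NormedSpace ℝ E]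

/-- Both sides are the ordinary derivative along the same coordinate line. This carries spatial
derivatives on the ambient chart to the geometry of `h(t, ·)` at fixed time. -/
theorem pd_x_eq_pd_slice (k : Fin d) {f : (WaveIndex d → ℝ) → E} {p : WaveIndex d → ℝ}
    (hf : DifferentiableAt ℝ f p) :
    pd (.x k) f p = pd k (fun y => f (slice p y)) (base p).2 := by
  have hs : DifferentiableAt ℝ (fun y => f (slice p y)) (base p).2 := by
    refine DifferentiableAt.comp (base p).2 ?_
      ((contDiff_slice (n := 1) p).differentiable (by simp)).differentiableAt
    rwa [slice_self]
  rw [pd_eq_deriv_update _ hf, pd_eq_deriv_update _ hs]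
  simp only [update_x]
  rfl

theorem pd_t_base {F : ℝ × (Fin d → ℝ) → E} {p : WaveIndex d → ℝ}
    (hF : DifferentiableAt ℝ F (base p)) :
    pd .t (fun y => F (base y)) p = deriv (fun s => F (s, (base p).2)) (base p).1 :=
  pd_eq_deriv_update .t (hF.comp p (contDiff_base.differentiable (n := 1) (by simp)).differentiableAt)

/-- Invariance of a function under translations in `u`. -/
def UInvariant (f : (WaveIndex d → ℝ) → E) : Prop :=
  ∀ p c, f (p + Pi.single .u c) = f p

theorem base_add_single_u (p : WaveIndex d → ℝ) (c : ℝ) : base (p + Pi.single .u c) = base p := by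
  simp [base]

theorem UInvariant.pd {f : (WaveIndex d → ℝ) → E} (hf : UInvariant f) (a : WaveIndex d) :
    UInvariant (pd a f) := by
  intro p c
  have : (fun y => f (y + Pi.single .u c)) = f := funext fun y => hf y c
  rw [_root_.pd, _root_.pd, ← fderiv_comp_add_right, this]

theorem UInvariant.pd_u {f : (WaveIndex d → ℝ) → E} (hf : UInvariant f) (p : WaveIndex d → ℝ) :
    _root_.pd .u f p = 0 := by
  by_cases hd : DifferentiableAt ℝ f p
  · rw [pd_eq_deriv_update _ hd]
    have : (fun s => f (Function.update p .u s)) = fun _ => f p := by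
      funext s
      rw [← hf p (s - p .u)]
      congr 1
      funext a
      by_cases ha : a = .u
      · subst ha; simp
      · simp [ha]
    rw [this, deriv_const]
  -- At points of non-differentiability `fderiv` is zero by convention, so the identity holds
  -- everywhere, including off the chart.
  · rw [_root_.pd, fderiv_zero_of_not_differentiableAt hd]; rfl

variable (P : PlatonicWave d)

/-- The part of the chart `ℝ × W` in the coordinates `(u, t, x)`. -/
def chart : Set (WaveIndex d → ℝ) := base ⁻¹' P.domain

theorem isOpen_chart : IsOpen P.chart :=
  P.isOpen_domain.preimage (contDiff_base (n := 0)).continuous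

/-- The spatial part of the chart at the time `t`. -/
def timeSlice (t : ℝ) : Set (Fin d → ℝ) := {y | (t, y) ∈ P.domain}

theorem contDiffOn_timeSlice {n : WithTop ℕ∞} {F : ℝ × (Fin d → ℝ) → E}
    (hF : ContDiffOn ℝ n F P.domain) (t : ℝ) :
    ContDiffOn ℝ n (fun y => F (t, y)) (P.timeSlice t) :=
  hF.comp (contDiff_prodMk_right t).contDiffOn fun _ hy => hy

theorem contDiffOn_chart {n : WithTop ℕ∞} {F : ℝ × (Fin d → ℝ) → E}
    (hF : ContDiffOn ℝ n F P.domain) : ContDiffOn ℝ n (fun p => F (base p)) P.chart :=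
  hF.comp contDiff_base.contDiffOn fun _ hy => hy

theorem chartMetric_spatial (t : ℝ) : ChartMetric (fun y => P.h (t, y)) (P.timeSlice t) where
  isOpen := P.isOpen_domain.preimage (Continuous.prodMk_right t)
  smooth i j := P.contDiffOn_timeSlice (P.smooth_h i j) t
  symm y hy i j := by simpa using ((P.h_posDef _ hy).isHermitian.apply i j).symm
  isUnit_det y hy := (P.h_posDef _ hy).det_pos.ne'.isUnit

/-- The inverse of the Bargmann metric. -/
noncomputable def bargmannInv (p : WaveIndex d → ℝ) : Matrix (WaveIndex d) (WaveIndex d) ℝ :=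
  Matrix.of fun
    | .u, .u => 2 * P.U (base p) +
        ∑ i, ∑ j, (P.h (base p))⁻¹ i j * (P.A (base p) i * P.A (base p) j)
    | .u, .t => 1
    | .t, .u => 1
    | .u, .x i => -∑ j, (P.h (base p))⁻¹ i j * P.A (base p) j
    | .x i, .u => -∑ j, (P.h (base p))⁻¹ i j * P.A (base p) j
    | .t, .t => 0
    | .t, .x _ => 0
    | .x _, .t => 0
    | .x i, .x j => (P.h (base p))⁻¹ i j

variable {P} {p : WaveIndex d → ℝ}

theorem bargmannInv_mul (hp : p ∈ P.chart) : P.bargmannInv p * P.bargmannMetric p = 1 := by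
  have hS := P.chartMetric_spatial (base p).1
  have hx : (base p).2 ∈ P.timeSlice (base p).1 := hp
  have h1 : ∀ i j, ∑ k, (P.h (base p))⁻¹ i k * P.h (base p) k j = if i = j then 1 else 0 :=
    hS.sum_inv_mul hx
  have h2 : ∀ j, ∑ i, (∑ l, (P.h (base p))⁻¹ i l * P.A (base p) l) * P.h (base p) i j =
      P.A (base p) j := by
    intro j
    have hsy : ∀ i l, (P.h (base p))⁻¹ i l = (P.h (base p))⁻¹ l i := hS.inv_symm hx
    simp only [Finset.sum_mul]
    rw [Finset.sum_comm]
    have : ∀ l i, (P.h (base p))⁻¹ i l * P.A (base p) l * P.h (base p) i j =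
        P.A (base p) l * ((P.h (base p))⁻¹ l i * P.h (base p) i j) := by
      intro l i; rw [hsy i l]; ring
    simp only [this, ← Finset.mul_sum, h1]
    simp
  ext a b
  rw [Matrix.mul_apply, sum_waveIndex]
  cases a <;> cases b <;>
    simp [bargmannInv, bargmannMetric, h1, h2, Matrix.one_apply]
  -- The remaining entry is `(u, t)`, where `2U + |A|²` has to cancel `-2U - A^i A_i`.
  have h3 : ∑ i, ∑ j, (P.h (base p))⁻¹ i j * (P.A (base p) i * P.A (base p) j) =
      ∑ i, (∑ j, (P.h (base p))⁻¹ i j * P.A (base p) j) * P.A (base p) i := by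
    simp only [Finset.sum_mul]
    exact Finset.sum_congr rfl fun i _ => Finset.sum_congr rfl fun j _ => by ring
  rw [h3]
  ring

theorem inv_bargmannMetric (hp : p ∈ P.chart) : (P.bargmannMetric p)⁻¹ = P.bargmannInv p :=
  Matrix.inv_eq_left_inv (bargmannInv_mul hp)

variable (P) in
theorem chartMetric_bargmann : ChartMetric P.bargmannMetric P.chart where
  isOpen := P.isOpen_chart
  smooth a b := by
    cases a <;> cases b
    · exact contDiffOn_const
    · exact contDiffOn_const
    · exact contDiffOn_const
    · exact contDiffOn_const
    · exact contDiffOn_const.mul (P.contDiffOn_chart P.smooth_U)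
    · exact P.contDiffOn_chart (P.smooth_A _)
    · exact contDiffOn_const
    · exact P.contDiffOn_chart (P.smooth_A _)
    · exact P.contDiffOn_chart (P.smooth_h _ _)
  symm p hp a b := by
    cases a <;> cases b <;> try rfl
    exact (P.chartMetric_spatial (base p).1).symm _ hp _ _
  isUnit_det p hp := Matrix.isUnit_det_of_left_inverse (bargmannInv_mul hp)

/-! ### Christoffel symbols and curvature of the Bargmann metric -/

theorem uInvariant_bargmannMetric (a b : WaveIndex d) :
    UInvariant fun p => P.bargmannMetric p a b := by
  intro p c
  simp only [bargmannMetric, base_add_single_u]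

theorem uInvariant_christoffel (k a b : WaveIndex d) :
    UInvariant (christoffel P.bargmannMetric k a b) := by
  intro p c
  have h : P.bargmannMetric (p + Pi.single .u c) = P.bargmannMetric p := by
    simp only [bargmannMetric, base_add_single_u]
  simp only [christoffel, h, fun e a b => (uInvariant_bargmannMetric (P := P) a b).pd e p c]

theorem pd_bargmannMetric_u_left (k b : WaveIndex d) :
    pd k (fun y => P.bargmannMetric y .u b) p = 0 := by
  cases b <;> exact pd_const _ _ _

theorem pd_bargmannMetric_u_right (k a : WaveIndex d) :
    pd k (fun y => P.bargmannMetric y a .u) p = 0 := by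
  cases a <;> exact pd_const _ _ _

/-- The only nonzero inverse entry in row `t` is `g^{tu} = 1`, so this symbol is `Γ` lowered to the
index `u`; the components `g_{ua}` are constant and nothing depends on `u`. -/
theorem christoffel_t (hp : p ∈ P.chart) (a b : WaveIndex d) :
    christoffel P.bargmannMetric .t a b p = 0 := by
  rw [christoffel, sum_waveIndex, inv_bargmannMetric hp, pd_bargmannMetric_u_right,
    pd_bargmannMetric_u_right, (uInvariant_bargmannMetric a b).pd_u]
  simp [bargmannInv]

theorem christoffel_u_left (k b : WaveIndex d) : christoffel P.bargmannMetric k .u b p = 0 := by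
  simp [christoffel, (uInvariant_bargmannMetric _ _).pd_u, pd_bargmannMetric_u_left]

theorem christoffel_u_right (k a : WaveIndex d) : christoffel P.bargmannMetric k a .u p = 0 := by
  simp [christoffel, (uInvariant_bargmannMetric _ _).pd_u, pd_bargmannMetric_u_right,
    pd_bargmannMetric_u_left]

theorem pd_h (hp : p ∈ P.chart) (k i j : Fin d) :
    pd (.x k) (fun y => P.bargmannMetric y (.x i) (.x j)) p =
      pd k (fun y => P.h ((base p).1, y) i j) (base p).2 :=
  pd_x_eq_pd_slice k ((chartMetric_bargmann P).differentiableAt hp _ _)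

theorem christoffel_x (hp : p ∈ P.chart) (k i j : Fin d) :
    christoffel P.bargmannMetric (.x k) (.x i) (.x j) p =
      christoffel (fun y => P.h ((base p).1, y)) k i j (base p).2 := by
  rw [christoffel, sum_waveIndex, inv_bargmannMetric hp, pd_bargmannMetric_u_right,
    pd_bargmannMetric_u_right, (uInvariant_bargmannMetric _ _).pd_u]
  simp [bargmannInv, christoffel, pd_h hp]

/-- Raising with `g^{ut} = 1` and `g^{ul} = -A^l` assembles the symmetrised covariant derivative of
`A` minus half of `∂_t h`. -/
theorem christoffel_u (hp : p ∈ P.chart) (i j : Fin d) :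
    christoffel P.bargmannMetric .u (.x i) (.x j) p =
      (1 / 2) * (pd i (fun y => P.A ((base p).1, y) j) (base p).2 +
        pd j (fun y => P.A ((base p).1, y) i) (base p).2 -
        deriv (fun s => P.h (s, (base p).2) i j) (base p).1) -
      ∑ l, P.A (base p) l * christoffel (fun y => P.h ((base p).1, y)) l i j (base p).2 := by
  have hA : ∀ i j, pd (.x i) (fun y => P.bargmannMetric y (.x j) .t) p =
      pd i (fun y => P.A ((base p).1, y) j) (base p).2 := fun i j =>
    pd_x_eq_pd_slice i ((chartMetric_bargmann P).differentiableAt hp _ _)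
  have ht : pd .t (fun y => P.bargmannMetric y (.x i) (.x j)) p =
      deriv (fun s => P.h (s, (base p).2) i j) (base p).1 :=
    pd_t_base (F := fun q => P.h q i j)
      (((P.smooth_h i j).contDiffAt (P.isOpen_domain.mem_nhds hp)).differentiableAt (by simp))
  have hsy : ∀ i l, (P.h (base p))⁻¹ i l = (P.h (base p))⁻¹ l i :=
    (P.chartMetric_spatial (base p).1).inv_symm hp
  rw [christoffel, sum_waveIndex, inv_bargmannMetric hp, pd_bargmannMetric_u_right,
    pd_bargmannMetric_u_right, (uInvariant_bargmannMetric _ _).pd_u, hA, hA, ht]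
  have e : ∀ L : Fin d → ℝ, ∑ l, (-∑ m, (P.h (base p))⁻¹ l m * P.A (base p) m) * L l =
      -∑ m, P.A (base p) m * ∑ l, (P.h (base p))⁻¹ m l * L l := by
    intro L
    simp only [neg_mul, Finset.sum_neg_distrib, Finset.sum_mul, Finset.mul_sum]
    rw [Finset.sum_comm]
    congr 1
    refine Finset.sum_congr rfl fun l _ => Finset.sum_congr rfl fun m _ => ?_
    rw [hsy m l]
    ring
  simp only [pd_h hp, bargmannInv, Matrix.of_apply, christoffel, e,
    mul_left_comm _ (1 / 2 : ℝ), ← Finset.mul_sum]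
  ring

theorem pd_christoffel_t (hp : p ∈ P.chart) (c a b : WaveIndex d) :
    pd c (christoffel P.bargmannMetric .t a b) p = 0 := by
  rw [pd_congr_of_isOpen P.isOpen_chart hp c fun y hy => christoffel_t hy a b, pd_const]

theorem pd_christoffel_u_left (c k b : WaveIndex d) :
    pd c (christoffel P.bargmannMetric k .u b) p = 0 := by
  rw [funext fun y => christoffel_u_left (P := P) (p := y) k b, pd_const]

theorem pd_christoffel_u_right (c k a : WaveIndex d) :
    pd c (christoffel P.bargmannMetric k a .u) p = 0 := by
  rw [funext fun y => christoffel_u_right (P := P) (p := y) k a, pd_const]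

theorem pd_christoffel_x (hp : p ∈ P.chart) (l k i j : Fin d) :
    pd (.x l) (christoffel P.bargmannMetric (.x k) (.x i) (.x j)) p =
      pd l (christoffel (fun y => P.h ((base p).1, y)) k i j) (base p).2 := by
  rw [pd_x_eq_pd_slice l ((chartMetric_bargmann P).differentiableAt_christoffel hp _ _ _)]
  exact pd_congr_of_isOpen (P.chartMetric_spatial (base p).1).isOpen hp l fun y hy =>
    christoffel_x (p := slice p y) hy k i j

theorem ricci_u_left (b : WaveIndex d) : ricci P.bargmannMetric .u b p = 0 := by
  simp [ricci, pd_christoffel_u_left, christoffel_u_left]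

theorem ricci_u_right (a : WaveIndex d) : ricci P.bargmannMetric a .u p = 0 := by
  simp [ricci, pd_christoffel_u_right, christoffel_u_left, christoffel_u_right,
    (uInvariant_christoffel _ _ _).pd_u]

/-- Summation indices `u` and `t` contribute nothing: `Γ^t` vanishes, symbols with a lower `u`
vanish, and the surviving `Γ^u_{ij}` occurs only under `∂_u` or next to such a zero factor. -/
theorem ricci_x (hp : p ∈ P.chart) (i j : Fin d) :
    ricci P.bargmannMetric (.x i) (.x j) p =
      ricci (fun y => P.h ((base p).1, y)) i j (base p).2 := by
  simp [ricci, sum_waveIndex, (uInvariant_christoffel _ _ _).pd_u, pd_christoffel_t hp,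
    pd_christoffel_u_right, christoffel_t hp, christoffel_u_left, christoffel_u_right,
    pd_christoffel_x hp, christoffel_x hp]

/-- The scalar curvature of the Bargmann metric is that of the spatial metric. -/
theorem scalarCurvature_bargmann (hp : p ∈ P.chart) :
    scalarCurvature P.bargmannMetric p = P.spatialCurvature (base p) := by
  -- The inverse metric has no `tt` or `tx` entries, so the Ricci components `R_tt` and `R_tx`,
  -- which involve `U` and `A`, never enter.
  rw [scalarCurvature, inv_bargmannMetric hp]
  simp [sum_waveIndex, ricci_u_left, ricci_u_right, ricci_x hp, bargmannInv, spatialCurvature,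
    scalarCurvature]

end PlatonicWave

/-! ### Plane waves in `u` and the main theorem -/

section GaugeLaplacian

variable {ι : Type} [Fintype ι] [DecidableEq ι]

/-- Expansion of `(∇ - ima)²` into Laplacian, transport, divergence and `m² |a|²` terms, the form in
which they emerge from the Bargmann Laplacian. -/
theorem ChartMetric.gaugeLaplacian_eq {g : (ι → ℝ) → Matrix ι ι ℝ} {S : Set (ι → ℝ)}
    (hg : ChartMetric g S) {x : ι → ℝ} (hx : x ∈ S) (m : ℝ) {a : (ι → ℝ) → ι → ℝ}
    (ha : ∀ i, ContDiffOn ℝ ∞ (fun y => a y i) S) {φ : (ι → ℝ) → ℂ} (hφ : ContDiffOn ℝ 2 φ S) :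
    gaugeLaplacian g m a φ x = laplaceBeltrami g φ x -
      2 * Complex.I * m * ∑ i, ∑ j, (((g x)⁻¹ i j * a x j : ℝ) : ℂ) * pd i φ x -
      Complex.I * m * ((∑ i, ∑ j, (g x)⁻¹ i j * (pd i (fun y => a y j) x -
        ∑ k, a x k * christoffel g k i j x) : ℝ) : ℂ) * φ x -
      (m : ℂ) ^ 2 * ((∑ i, ∑ j, (g x)⁻¹ i j * (a x i * a x j) : ℝ) : ℂ) * φ x := by
  have hφ1 : DifferentiableAt ℝ φ x :=
    (hφ.contDiffAt (hg.isOpen.mem_nhds hx)).differentiableAt (by simp)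
  have hφ2 : ∀ j, DifferentiableAt ℝ (pd j φ) x := fun j =>
    ((contDiffOn_pd (m := 1) j hg.isOpen hφ (by norm_num)).contDiffAt
      (hg.isOpen.mem_nhds hx)).differentiableAt (by simp)
  have ha1 : ∀ j, DifferentiableAt ℝ (fun y => a y j) x := fun j =>
    ((ha j).contDiffAt (hg.isOpen.mem_nhds hx)).differentiableAt (by simp)
  have ha2 : ∀ j, DifferentiableAt ℝ (fun y => (a y j : ℂ)) x := fun j =>
    Complex.ofRealCLM.differentiableAt.comp x (ha1 j)
  have ha3 : ∀ j, DifferentiableAt ℝ (fun y => Complex.I * (m : ℂ) * (a y j : ℂ)) x := fun j =>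
    (ha2 j).const_mul _
  have hD : ∀ i j, gaugeDeriv m a i (gaugeDeriv m a j φ) x = pd i (pd j φ) x -
      (Complex.I * m * (pd i (fun y => a y j) x : ℝ) * φ x +
        Complex.I * m * (a x j : ℂ) * pd i φ x) -
      Complex.I * m * (a x i : ℂ) * (pd j φ x - Complex.I * m * (a x j : ℂ) * φ x) := by
    intro i j
    rw [gaugeDeriv]
    rw [show gaugeDeriv m a j φ = fun y => pd j φ y - Complex.I * m * (a y j : ℂ) * φ y from rfl,
      pd_sub i (hφ2 j) ((ha3 j).fun_mul hφ1), pd_mul i (ha3 j) hφ1, pd_const_mul i _ (ha2 j),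
      pd_ofReal i (ha1 j)]
  have hswap : ∑ i, ∑ j, (((g x)⁻¹ i j * a x i : ℝ) : ℂ) * pd j φ x =
      ∑ i, ∑ j, (((g x)⁻¹ i j * a x j : ℝ) : ℂ) * pd i φ x := by
    rw [Finset.sum_comm]
    exact Finset.sum_congr rfl fun i _ => Finset.sum_congr rfl fun j _ => by rw [hg.inv_symm hx]
  have hterm : ∀ i j, (((g x)⁻¹ i j : ℝ) : ℂ) * (gaugeDeriv m a i (gaugeDeriv m a j φ) x -
        ∑ k, (christoffel g k i j x : ℂ) * gaugeDeriv m a k φ x) =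
      (((g x)⁻¹ i j : ℝ) : ℂ) * (pd i (pd j φ) x - ∑ k, (christoffel g k i j x : ℂ) * pd k φ x) -
      Complex.I * m * ((((g x)⁻¹ i j * a x j : ℝ) : ℂ) * pd i φ x) -
      Complex.I * m * ((((g x)⁻¹ i j * a x i : ℝ) : ℂ) * pd j φ x) -
      Complex.I * m * φ x * (((g x)⁻¹ i j * (pd i (fun y => a y j) x -
        ∑ k, a x k * christoffel g k i j x) : ℝ) : ℂ) -
      (m : ℂ) ^ 2 * φ x * (((g x)⁻¹ i j * (a x i * a x j) : ℝ) : ℂ) := by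
    intro i j
    have hs : ∑ k, (christoffel g k i j x : ℂ) * gaugeDeriv m a k φ x =
        ∑ k, (christoffel g k i j x : ℂ) * pd k φ x -
        Complex.I * m * φ x * ∑ k, ((a x k : ℂ) * (christoffel g k i j x : ℂ)) := by
      simp only [gaugeDeriv, Finset.mul_sum, ← Finset.sum_sub_distrib]
      exact Finset.sum_congr rfl fun k _ => by ring
    rw [hs, hD]
    push_cast
    linear_combination (((g x)⁻¹ i j : ℝ) : ℂ) * (a x i : ℂ) * (a x j : ℂ) * (m : ℂ) ^ 2 * φ x *
      Complex.I_sq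
  simp only [gaugeLaplacian, hterm]
  simp only [← Finset.mul_sum, Finset.sum_sub_distrib, hswap, laplaceBeltrami, Complex.ofReal_sum]
  ring

end GaugeLaplacian

/-! ### The Bargmann Laplacian on a Fourier mode in `u` -/

namespace PlatonicWave

variable {d : ℕ}

/-- The plane wave `ψ(t, x) e^{i m u}`. -/
noncomputable def wave (m : ℝ) (ψ : ℝ × (Fin d → ℝ) → ℂ) (p : WaveIndex d → ℝ) : ℂ :=
  ψ (base p) * Complex.exp (Complex.I * m * p .u)

theorem contDiff_phase {n : WithTop ℕ∞} (m : ℝ) :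
    ContDiff ℝ n fun p : WaveIndex d → ℝ => Complex.exp (Complex.I * m * p .u) :=
  (contDiff_const.mul (Complex.ofRealCLM.contDiff.comp (contDiff_apply ℝ ℝ _))).cexp

theorem pd_u_wave {m : ℝ} {ψ : ℝ × (Fin d → ℝ) → ℂ} {p : WaveIndex d → ℝ}
    (hψ : DifferentiableAt ℝ (wave m ψ) p) : pd .u (wave m ψ) p = Complex.I * m * wave m ψ p := by
  rw [pd_eq_deriv_update _ hψ]
  simp only [wave, base_update_u, Function.update_self]
  have h1 : HasDerivAt (fun s : ℝ => Complex.I * m * (s : ℂ)) (Complex.I * m * 1) (p .u) :=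
    (Complex.ofRealCLM.hasDerivAt (x := p .u)).const_mul _
  rw [(h1.cexp.const_mul (ψ (base p))).deriv]
  ring

theorem pd_t_wave {m : ℝ} {ψ : ℝ × (Fin d → ℝ) → ℂ} {p : WaveIndex d → ℝ}
    (hψ : DifferentiableAt ℝ (wave m ψ) p) :
    pd .t (wave m ψ) p = wave m (fun q => deriv (fun s => ψ (s, q.2)) q.1) p := by
  rw [pd_eq_deriv_update _ hψ]
  have : ∀ s, (Function.update p .t s) (.u : WaveIndex d) = p .u := fun s => rfl
  simp only [wave, base_update_t, this, deriv_mul_const_field]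
  rfl

theorem pd_x_wave {m : ℝ} {ψ : ℝ × (Fin d → ℝ) → ℂ} {p : WaveIndex d → ℝ} (k : Fin d)
    (hψ : DifferentiableAt ℝ (wave m ψ) p)
    (hψ' : DifferentiableAt ℝ (fun y => ψ ((base p).1, y)) (base p).2) :
    pd (.x k) (wave m ψ) p = wave m (fun q => pd k (fun y => ψ (q.1, y)) q.2) p := by
  rw [pd_x_eq_pd_slice _ hψ]
  change pd k (fun y => ψ ((base p).1, y) * Complex.exp (Complex.I * m * p .u)) _ = _
  rw [pd_mul k hψ' (differentiableAt_const _), pd_const, mul_zero, add_zero]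
  rfl

variable {P : PlatonicWave d} {p : WaveIndex d → ℝ}

theorem contDiffOn_wave {n : WithTop ℕ∞} {m : ℝ} {ψ : ℝ × (Fin d → ℝ) → ℂ}
    (hψ : ContDiffOn ℝ n ψ P.domain) : ContDiffOn ℝ n (wave m ψ) P.chart :=
  (P.contDiffOn_chart hψ).mul (contDiff_phase m).contDiffOn

/-- The trace of `Γ^u_{ij}` is `div A` minus half the trace of `h⁻¹ ∂_t h`; by Jacobi's formula the
latter is `∂_t ln det h`, the source of the determinant term. -/
theorem sum_inv_mul_christoffel_u (hp : p ∈ P.chart) :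
    ∑ i, ∑ j, (P.h (base p))⁻¹ i j * christoffel P.bargmannMetric .u (.x i) (.x j) p =
      ∑ i, ∑ j, (P.h (base p))⁻¹ i j * (pd i (fun y => P.A ((base p).1, y) j) (base p).2 -
        ∑ k, P.A (base p) k * christoffel (fun y => P.h ((base p).1, y)) k i j (base p).2) -
      (1 / 2) * P.dtLogDet (base p) := by
  have hswap : ∀ X : Fin d → Fin d → ℝ, ∑ i, ∑ j, (P.h (base p))⁻¹ i j * X j i =
      ∑ i, ∑ j, (P.h (base p))⁻¹ i j * X i j :=
    (P.chartMetric_spatial (base p).1).sum_inv_mul_swap hp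
  have hdet : P.dtLogDet (base p) = ∑ i, ∑ j, (P.h (base p))⁻¹ i j *
      deriv (fun s => P.h (s, (base p).2) i j) (base p).1 := by
    have hd : ∀ i j, HasDerivAt (fun s => P.h (s, (base p).2) i j)
        (Matrix.of (fun i j => deriv (fun s => P.h (s, (base p).2) i j) (base p).1) i j)
        (base p).1 := by
      intro i j
      have h1 : DifferentiableAt ℝ (fun q => P.h q i j) ((base p).1, (base p).2) :=
        ((P.smooth_h i j).contDiffAt (P.isOpen_domain.mem_nhds hp)).differentiableAt (by simp)
      have h2 : DifferentiableAt ℝ (fun s : ℝ => (s, (base p).2)) (base p).1 :=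
        differentiableAt_id.prodMk (differentiableAt_const _)
      exact (h1.comp (base p).1 h2).hasDerivAt
    rw [dtLogDet, deriv_log_det hd ((P.chartMetric_spatial (base p).1).isUnit_det _ hp)]
    exact hswap _
  have hterm : ∀ i j, (P.h (base p))⁻¹ i j * christoffel P.bargmannMetric .u (.x i) (.x j) p =
      (1 / 2) * ((P.h (base p))⁻¹ i j * pd i (fun y => P.A ((base p).1, y) j) (base p).2) +
      (1 / 2) * ((P.h (base p))⁻¹ i j * pd j (fun y => P.A ((base p).1, y) i) (base p).2) -
      (1 / 2) * ((P.h (base p))⁻¹ i j * deriv (fun s => P.h (s, (base p).2) i j) (base p).1) -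
      (P.h (base p))⁻¹ i j *
        ∑ k, P.A (base p) k * christoffel (fun y => P.h ((base p).1, y)) k i j (base p).2 := by
    intro i j
    rw [christoffel_u hp]
    ring
  simp only [hterm, mul_sub, Finset.sum_add_distrib, Finset.sum_sub_distrib, ← Finset.mul_sum,
    hdet, hswap fun i j => pd i (fun y => P.A ((base p).1, y) j) (base p).2]
  ring

/-- The Laplace-Beltrami operator of the Bargmann metric on plane waves in `u`. -/
theorem laplaceBeltrami_bargmann (hp : p ∈ P.chart) (m : ℝ) {φ : ℝ × (Fin d → ℝ) → ℂ}
    (hφ : ContDiffOn ℝ 2 φ P.domain) :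
    laplaceBeltrami P.bargmannMetric (wave m φ) p = Complex.exp (Complex.I * m * p .u) *
      (P.gaugeLap m φ (base p) +
        2 * Complex.I * m * deriv (fun s => φ (s, (base p).2)) (base p).1 +
        (1 / 2) * Complex.I * m * (P.dtLogDet (base p) : ℂ) * φ (base p) -
        2 * (m : ℂ) ^ 2 * P.U (base p) * φ (base p)) := by
  have hF := contDiffOn_wave (m := m) hφ
  have hF1 : ∀ y ∈ P.chart, DifferentiableAt ℝ (wave m φ) y := fun y hy =>
    (hF.contDiffAt (P.isOpen_chart.mem_nhds hy)).differentiableAt (by simp)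
  have hF2 : ∀ a, DifferentiableAt ℝ (pd a (wave m φ)) p := fun a =>
    ((contDiffOn_pd (m := 1) a P.isOpen_chart hF (by norm_num)).contDiffAt
      (P.isOpen_chart.mem_nhds hp)).differentiableAt (by simp)
  have hS := P.chartMetric_spatial (base p).1
  have hφt := P.contDiffOn_timeSlice hφ
  have hφ1 : ∀ y ∈ P.chart, DifferentiableAt ℝ (fun z => φ ((base y).1, z)) (base y).2 :=
    fun y hy => ((hφt _).contDiffAt
      ((P.chartMetric_spatial (base y).1).isOpen.mem_nhds hy)).differentiableAt (by simp)
  have hpx : ∀ k, ∀ y ∈ P.chart, pd (.x k) (wave m φ) y =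
      wave m (fun q => pd k (fun y => φ (q.1, y)) q.2) y := fun k y hy =>
    pd_x_wave k (hF1 y hy) (hφ1 y hy)
  have hpt : ∀ y ∈ P.chart, pd .t (wave m φ) y =
      wave m (fun q => deriv (fun s => φ (s, q.2)) q.1) y := fun y hy => pd_t_wave (hF1 y hy)
  have hpu : ∀ y ∈ P.chart, pd .u (wave m φ) y = Complex.I * m * wave m φ y := fun y hy =>
    pd_u_wave (hF1 y hy)
  have hau : ∀ a, pd a (pd .u (wave m φ)) p = Complex.I * m * pd a (wave m φ) p := by
    intro a
    rw [pd_congr_of_isOpen P.isOpen_chart hp a hpu, pd_const_mul a _ (hF1 p hp)]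
  -- No commutation of partial derivatives is needed: on the chart, `∂_a` of the wave is again a
  -- wave with the same `m`.
  have hua : ∀ a ψ, (∀ y ∈ P.chart, pd a (wave m φ) y = wave m ψ y) →
      pd .u (pd a (wave m φ)) p = Complex.I * m * pd a (wave m φ) p := by
    intro a ψ h
    have he := Filter.eventually_of_mem (P.isOpen_chart.mem_nhds hp) h
    rw [pd_congr .u he, pd_u_wave ((hF2 a).congr_of_eventuallyEq (he.mono fun _ h => h.symm)),
      h p hp]
  have hxx : ∀ i j, pd (.x i) (pd (.x j) (wave m φ)) p =
      pd i (pd j fun y => φ ((base p).1, y)) (base p).2 * Complex.exp (Complex.I * m * p .u) := by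
    intro i j
    have hd : DifferentiableAt ℝ (pd j fun y => φ ((base p).1, y)) (base p).2 :=
      ((contDiffOn_pd (m := 1) j hS.isOpen (hφt _) (by norm_num)).contDiffAt
        (hS.isOpen.mem_nhds hp)).differentiableAt (by simp)
    rw [pd_x_eq_pd_slice i (hF2 _), pd_congr_of_isOpen (x := (base p).2) hS.isOpen hp i
      fun y hy => hpx j (slice p y) hy]
    change pd i (fun y => pd j (fun y => φ ((base p).1, y)) y *
      Complex.exp (Complex.I * m * p .u)) _ = _
    rw [pd_mul i hd (differentiableAt_const _), pd_const, mul_zero, add_zero]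
  have hterm : ∀ i j, (((P.h (base p))⁻¹ i j : ℝ) : ℂ) * (pd (.x i) (pd (.x j) (wave m φ)) p -
      ((christoffel P.bargmannMetric .u (.x i) (.x j) p : ℂ) * pd .u (wave m φ) p +
        ((christoffel P.bargmannMetric .t (.x i) (.x j) p : ℂ) * pd .t (wave m φ) p +
        ∑ k, (christoffel P.bargmannMetric (.x k) (.x i) (.x j) p : ℂ) *
          pd (.x k) (wave m φ) p))) =
      Complex.exp (Complex.I * m * p .u) * ((((P.h (base p))⁻¹ i j : ℝ) : ℂ) *
        (pd i (pd j fun y => φ ((base p).1, y)) (base p).2 -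
          ∑ k, (christoffel (fun y => P.h ((base p).1, y)) k i j (base p).2 : ℂ) *
            pd k (fun y => φ ((base p).1, y)) (base p).2) -
        Complex.I * m * φ (base p) * (((P.h (base p))⁻¹ i j *
          christoffel P.bargmannMetric .u (.x i) (.x j) p : ℝ) : ℂ)) := by
    intro i j
    have hs : ∑ k, (christoffel P.bargmannMetric (.x k) (.x i) (.x j) p : ℂ) *
          pd (.x k) (wave m φ) p = Complex.exp (Complex.I * m * p .u) *
        ∑ k, (christoffel (fun y => P.h ((base p).1, y)) k i j (base p).2 : ℂ) *
            pd k (fun y => φ ((base p).1, y)) (base p).2 := by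
      rw [Finset.mul_sum]
      refine Finset.sum_congr rfl fun k _ => ?_
      rw [christoffel_x hp, hpx k p hp, wave]
      ring
    rw [hs, hxx, hpu p hp, christoffel_t hp, wave]
    push_cast
    ring
  have hgauge := hS.gaugeLaplacian_eq (x := (base p).2) hp m
    (fun i => P.contDiffOn_timeSlice (P.smooth_A i) _) (hφt _)
  have hΓ := sum_inv_mul_christoffel_u hp
  have hΓ' := congrArg Complex.ofReal hΓ
  simp only [Complex.ofReal_sum] at hΓ'
  simp only [Prod.mk.eta] at hgauge
  have hux : ∑ i, (((-∑ j, (P.h (base p))⁻¹ i j * P.A (base p) j : ℝ)) : ℂ) *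
      (Complex.I * m * pd (.x i) (wave m φ) p) =
      -(Complex.I * m * Complex.exp (Complex.I * m * p .u) *
        ∑ i, ∑ j, (((P.h (base p))⁻¹ i j * P.A (base p) j : ℝ) : ℂ) *
          pd i (fun y => φ ((base p).1, y)) (base p).2) := by
    rw [Finset.mul_sum, ← Finset.sum_neg_distrib]
    refine Finset.sum_congr rfl fun i _ => ?_
    rw [hpx i p hp, wave, ← Finset.sum_mul, Complex.ofReal_neg, Complex.ofReal_sum]
    ring
  rw [laplaceBeltrami, inv_bargmannMetric hp]
  simp only [sum_waveIndex, christoffel_u_left, christoffel_u_right, Complex.ofReal_zero,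
    zero_mul, Finset.sum_const_zero, add_zero, sub_zero, bargmannInv, Matrix.of_apply, hau,
    hua .t _ hpt, fun k => hua (.x k) _ (hpx k), zero_add, Complex.ofReal_one, one_mul,
    Finset.sum_add_distrib, hux, hterm]
  simp only [← Finset.mul_sum, Finset.sum_sub_distrib, hΓ', hpu p hp, hpt p hp]
  rw [gaugeLap, hgauge]
  simp only [laplaceBeltrami, wave]
  push_cast
  -- The coefficient is `g^{uu} m²` times the wave: `∂_u² = (im)²` is multiplied by `g^{uu} = 2U +
  -- |A|²`. The `|A|²` part matches the quadratic term of the gauge Laplacian and the rest is `-2m²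
  -- U`.
  linear_combination (2 * P.U (base p) + ∑ i, ∑ j, (((P.h (base p))⁻¹ i j : ℝ) : ℂ) *
    ((P.A (base p) i : ℂ) * (P.A (base p) j : ℂ))) * (m : ℂ) ^ 2 * φ (base p) *
    Complex.exp (Complex.I * m * p .u) * Complex.I_sq

end PlatonicWave

/-! ### Assembly for the Platonic wave -/

theorem mainTheorem8 {d : ℕ} (P : PlatonicWave d) (m M : ℝ) (φ : ℝ × (Fin d → ℝ) → ℂ)
    (hφ : ContDiffOn ℝ 2 φ P.domain) (p : WaveIndex d → ℝ) (q : ℝ × (Fin d → ℝ))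
    (hpq : PlatonicWave.base p = q) (hq : q ∈ P.domain) :
    P.kleinGordon M (P.ansatz m φ) p =
        ((P.Ω q ^ (-1 - (d : ℝ) / 4) : ℝ) : ℂ) * Complex.exp (Complex.I * m * p .u) *
          (P.gaugeLap m φ q +
            2 * Complex.I * m * deriv (fun s => φ (s, q.2)) q.1 +
            (1 / 2) * Complex.I * m * (P.dtLogDet q : ℂ) * φ q -
            ((M : ℂ) ^ 2 * P.Ω q + 2 * (m : ℂ) ^ 2 * P.U q +
              ((d : ℂ) / (4 * ((d : ℂ) + 1))) * (P.spatialCurvature q : ℂ)) * φ q) ∧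
      (m ≠ 0 → (P.kleinGordon M (P.ansatz m φ) p = 0 ↔ P.SchrodingerAt m M φ q)) := by
  subst hpq
  have hΩ := P.Ω_pos _ hq
  have hcard : (Fintype.card (WaveIndex d) : ℝ) = d + 2 := by
    rw [PlatonicWave.card_waveIndex]; push_cast; ring
  have hd1 : (d : ℝ) + 1 ≠ 0 := by positivity
  have hY : yamabe P.metric (P.ansatz m φ) p =
      ((P.Ω (PlatonicWave.base p) ^ (-(d : ℝ) / 4 - 1) : ℝ) : ℂ) *
        yamabe P.bargmannMetric (PlatonicWave.wave m φ) p := by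
    have := (PlatonicWave.chartMetric_bargmann P).yamabe_smul
      (P.contDiffOn_chart P.smooth_Ω) (fun y hy => P.Ω_pos _ hy) (x := p) hq
      (s := -(d : ℝ) / 4) (by rw [hcard]; ring) (by rw [hcard]; intro h; apply hd1; linarith)
      (PlatonicWave.contDiffOn_wave (m := m) hφ)
    simp only [PlatonicWave.wave, ← mul_assoc] at this
    exact this
  have key : P.kleinGordon M (P.ansatz m φ) p =
        ((P.Ω (PlatonicWave.base p) ^ (-1 - (d : ℝ) / 4) : ℝ) : ℂ) *
          Complex.exp (Complex.I * m * p .u) *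
          (P.gaugeLap m φ (PlatonicWave.base p) +
            2 * Complex.I * m *
              deriv (fun s => φ (s, (PlatonicWave.base p).2)) (PlatonicWave.base p).1 +
            (1 / 2) * Complex.I * m * (P.dtLogDet (PlatonicWave.base p) : ℂ) *
              φ (PlatonicWave.base p) -
            ((M : ℂ) ^ 2 * P.Ω (PlatonicWave.base p) +
              2 * (m : ℂ) ^ 2 * P.U (PlatonicWave.base p) +
              ((d : ℂ) / (4 * ((d : ℂ) + 1))) *
                (P.spatialCurvature (PlatonicWave.base p) : ℂ)) * φ (PlatonicWave.base p)) := by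
    have hs : (-1 - (d : ℝ) / 4) = -(d : ℝ) / 4 - 1 := by ring
    -- The mass term is not conformally covariant; splitting off one power of `Ω` brings it to the
    -- common prefactor as `M² Ω`.
    have hpow : P.Ω (PlatonicWave.base p) ^ (-(d : ℝ) / 4) =
        P.Ω (PlatonicWave.base p) ^ (-(d : ℝ) / 4 - 1) * P.Ω (PlatonicWave.base p) := by
      rw [Real.rpow_sub_one hΩ.ne', div_mul_cancel₀ _ hΩ.ne']
    have hc : ((d : ℝ) + 2 - 2) / (4 * ((d : ℝ) + 2 - 1)) = d / (4 * (d + 1)) := by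
      ring_nf
    rw [PlatonicWave.kleinGordon, hY, yamabe, PlatonicWave.laplaceBeltrami_bargmann hq m hφ,
      PlatonicWave.scalarCurvature_bargmann hq, hcard, hc, PlatonicWave.ansatz, hpow, hs,
      PlatonicWave.wave]
    push_cast
    ring
  refine ⟨key, fun hm => ?_⟩
  have hm' : (m : ℂ) ≠ 0 := by exact_mod_cast hm
  have hpre : ((P.Ω (PlatonicWave.base p) ^ (-1 - (d : ℝ) / 4) : ℝ) : ℂ) *
      Complex.exp (Complex.I * m * p .u) ≠ 0 :=
    mul_ne_zero (by exact_mod_cast (Real.rpow_pos_of_pos hΩ _).ne') (Complex.exp_ne_zero _)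
  rw [key, mul_eq_zero, or_iff_right hpre, PlatonicWave.SchrodingerAt,
    PlatonicWave.effectivePotential]
  have h2m : (2 * (m : ℂ)) ≠ 0 := mul_ne_zero two_ne_zero hm'
  -- Multiplied by `2m`, the difference of the two sides of the Schrödinger equation is exactly the
  -- bracket, since `2m² V = 2m² U + M² Ω`.
  conv_rhs => rw [← sub_eq_zero, ← mul_right_inj' h2m, mul_zero]
  refine Eq.congr ?_ rfl
  push_cast
  field_simp
  ring
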